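/- Let $n\ge 1$ and let $f_1,\dots,f_n:\mathbb{R}^d\to\mathbb{R}$ be twice continuously differentiable functions that are, for constants $\mu,L>0$ and $\tilde L\ge 0$, $\mu$-strongly convex and $L$-smooth, i.e. $\frac{\mu}{2}\|y-x\|^2\le f_i(y)-f_i(x)-\langle\nabla f_i(x),y-x\rangle\le\frac{L}{2}\|y-x\|^2$ for all $x,y$, and have $\tilde L$-Lipschitz Hessians, i.e. $\|\nabla^2f_i(y)-\nabla^2f_i(x)\|\le\tilde L\|y-x\|$ for all $x,y$ (spectral norm). Let $x^\star=\arg\min_x\frac1n\sum_{i=1}^nf_i(x)$ and $M=\tilde L\mu^{-3/2}$. For matrices $B,K$ put $\sigma(B,K)=\mathrm{Tr}\big((K^{-1})^{\mathsf T}(B-K)\big)$ and, for a vector $u\neq 0$, $$\mathrm{BFGS}(B,K,u)=B-\frac{Buu^{\mathsf T}B}{\langle u,Bu\rangle}+\frac{Kuu^{\mathsf T}K}{\langle u,Ku\rangle},\qquad \mathrm{BFGS}(B,K,0)=B.$$ Given $\rho,\epsilon>0$, put $\alpha_k=M\sqrt L\,\epsilon\rho^k$ for $k\ge 0$. Given $x^0\in\mathbb{R}^d$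 and matrices $I_1^0,\dots,I_n^0$, the SLIQN method sets $z_i^0=x^0$, $D_i^0=(1+\alpha_0)^2I_i^0$ for all $i$, and for $t=1,2,\dots$, with $i_t=1+(t-1)\bmod n$ and $\omega_t=(1+\alpha_{\lceil t/n\rceil})^2$ if $n\mid t$, $\omega_t=1$ otherwise: - $x^t=\big(\sum_{i=1}^nD_i^{t-1}\big)^{-1}\sum_{i=1}^n\big(D_i^{t-1}z_i^{t-1}-\nabla f_i(z_i^{t-1})\big)$; - $z_{i_t}^t=x^t$, and $z_i^t=z_i^{t-1}$, $D_i^t=\omega_tD_i^{t-1}$ for $i\ne i_t$; - $Q^t=\mathrm{BFGS}\big(D_{i_t}^{t-1},(1+\alpha_{\lceil t/n-1\rceil})K^t,z_{i_t}^t-z_{i_t}^{t-1}\big)$, where $K^t=\int_0^1\nabla^2f_{i_t}\big(z_{i_t}^{t-1}+\tau(z_{i_t}^t-z_{i_t}^{t-1})\big)\,d\tau$; - $D_{i_t}^t=\omega_t\,\mathrm{BFGS}\big(Q^t,\nabla^2f_{i_t}(z_{i_t}^t),\bar u^t\big)$, where $\bar u^t$ is any maximizer of $\langle u,Q^tu\rangle/\langle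 u,\nabla^2f_{i_t}(z_{i_t}^t)u\rangle$ over the standard basis vectors $u\in\{e_1,\dots,e_d\}$. Then for every $\rho$ with $0<\rho<1-\frac{\mu}{dL}$ there exist $\epsilon>0$ and $\sigma_0>0$ such that, whenever $\|x^0-x^\star\|\le\epsilon$ and, for all $i\in\{1,\dots,n\}$, $I_i^0-\nabla^2f_i(x^0)$ is symmetric positive semidefinite and $\sigma(I_i^0,\nabla^2f_i(x^0))\le\sigma_0$, all sequences generated by the SLIQN method with $\alpha_k=M\sqrt L\,\epsilon\rho^k$ satisfy, for all $t\ge 1$: the matrices $D_i^{t-1}$ ($1\le i\le n$) and $Q^t$ are positive definite (so every step is well defined), and $$\|x^t-x^\star\|\le\Big(1-\frac{\mu}{dL}\Big)^{\lceil t/n\rceil}\,\frac1n\sum_{i=1}^n\|x^{t-i}-x^\star\|,$$ where $x^{t-i}:=x^0$ if $t<i$. -/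

import Mathlib

noncomputable section

namespace SLIQN

/-- The Hessian of `f` at `x` as a linear operator: the derivative of the gradient.
Its operator norm is the spectral norm. -/
def hessOp {d : ℕ} (f : EuclideanSpace ℝ (Fin d) → ℝ) (x : EuclideanSpace ℝ (Fin d)) :
    EuclideanSpace ℝ (Fin d) →L[ℝ] EuclideanSpace ℝ (Fin d) :=
  fderiv ℝ (gradient f) x

/-- The Hessian matrix of `f` at `x`. -/
def hess {d : ℕ} (f : EuclideanSpace ℝ (Fin d) → ℝ) (x : EuclideanSpace ℝ (Fin d)) :
    Matrix (Fin d) (Fin d) ℝ :=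
  (Matrix.toEuclideanCLM (n := Fin d) (𝕜 := ℝ)).symm (hessOp f x)

/-- The averaged Hessian `∫₀¹ ∇²f(x + τ (y - x)) dτ` (entrywise integral). -/
def avgHess {d : ℕ} (f : EuclideanSpace ℝ (Fin d) → ℝ) (x y : EuclideanSpace ℝ (Fin d)) :
    Matrix (Fin d) (Fin d) ℝ :=
  Matrix.of fun i j => ∫ τ in (0 : ℝ)..1, hess f (x + τ • (y - x)) i j

/-- `f` is `μ`-strongly convex: `(μ/2)‖y - x‖² ≤ f y - f x - ⟨∇f x, y - x⟩`. -/
def StronglyConvex {d : ℕ} (μ : ℝ) (f : EuclideanSpace ℝ (Fin d) → ℝ) : Prop :=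
  ∀ x y, μ / 2 * ‖y - x‖ ^ 2 ≤ f y - f x - inner ℝ (gradient f x) (y - x)

/-- `f` is `L`-smooth: `f y - f x - ⟨∇f x, y - x⟩ ≤ (L/2)‖y - x‖²`. -/
def Smooth {d : ℕ} (L : ℝ) (f : EuclideanSpace ℝ (Fin d) → ℝ) : Prop :=
  ∀ x y, f y - f x - inner ℝ (gradient f x) (y - x) ≤ L / 2 * ‖y - x‖ ^ 2

/-- The Hessian of `f` is `Lt`-Lipschitz in the spectral norm. -/
def LipschitzHessian {d : ℕ} (Lt : ℝ) (f : EuclideanSpace ℝ (Fin d) → ℝ) : Prop :=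
  ∀ x y, ‖hessOp f y - hessOp f x‖ ≤ Lt * ‖y - x‖

/-- The generalized BFGS update `B - B u uᵀ B / ⟨u, B u⟩ + K u uᵀ K / ⟨u, K u⟩`.
For `u = 0` it returns `B` (there is no direction to update along). -/
def bfgs {d : ℕ} (B K : Matrix (Fin d) (Fin d) ℝ) (u : Fin d → ℝ) :
    Matrix (Fin d) (Fin d) ℝ :=
  B - (u ⬝ᵥ B.mulVec u)⁻¹ • (B * Matrix.vecMulVec u u * B)
    + (u ⬝ᵥ K.mulVec u)⁻¹ • (K * Matrix.vecMulVec u u * K)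

/-- `u` is a greedy vector of `B` with respect to `K`: it maximizes `⟨u, B u⟩ / ⟨u, K u⟩` among
the standard basis vectors. Ties may be broken in any way. -/
def IsGreedy {d : ℕ} (B K : Matrix (Fin d) (Fin d) ℝ) (u : Fin d → ℝ) : Prop :=
  u ∈ Set.range (fun k : Fin d => (Pi.single k 1 : Fin d → ℝ)) ∧
    IsMaxOn (fun v : Fin d → ℝ => (v ⬝ᵥ B.mulVec v) / (v ⬝ᵥ K.mulVec v))
      (Set.range (fun k : Fin d => (Pi.single k 1 : Fin d → ℝ))) u

/-- The approximation error `σ(B, K) = ⟨K⁻¹, B - K⟩`, with `⟨X, Y⟩ = Tr(Xᵀ Y)`. -/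
def sigma {d : ℕ} (B K : Matrix (Fin d) (Fin d) ℝ) : ℝ :=
  ((K⁻¹).transpose * (B - K)).trace

/-- The index `i_t` updated at iteration `t ≥ 1`, in zero-based numbering: `(t - 1) mod n`. -/
def idx (n : ℕ) [NeZero n] (t : ℕ) : Fin n :=
  ⟨(t - 1) % n, Nat.mod_lt _ (NeZero.pos n)⟩

/-- The correction factors `α_k = M √L ε ρ ^ k`, with `M = Lt μ ^ (-3/2)`. -/
def alpha (μ L Lt ε ρ : ℝ) (k : ℕ) : ℝ :=
  Lt * μ ^ (-(3 / 2) : ℝ) * √L * ε * ρ ^ k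

/-- The scaling `ω_t`: equal to `(1 + α_⌈t/n⌉)²` if `n ∣ t`, and to `1` otherwise. -/
def omega (α : ℕ → ℝ) (n t : ℕ) : ℝ :=
  if t % n = 0 then (1 + α ⌈(t : ℝ) / n⌉₊) ^ 2 else 1

/-- `(x, z, D, Q, u)` is a run of SLIQN on `f_1, …, f_n` with correction factors `α`, started
from the point `x0` and the matrices `I0 i`. Here `x t`, `z t i`, `D t i` are the iterates and
`Q t`, `u t` (for `t ≥ 1`) are the intermediate matrix and the greedy vector of iteration `t`. -/
structure IsRun {d n : ℕ} [NeZero n] (f : Fin n → EuclideanSpace ℝ (Fin d) → ℝ) (α : ℕ → ℝ)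
    (x0 : EuclideanSpace ℝ (Fin d)) (I0 : Fin n → Matrix (Fin d) (Fin d) ℝ)
    (x : ℕ → EuclideanSpace ℝ (Fin d)) (z : ℕ → Fin n → EuclideanSpace ℝ (Fin d))
    (D : ℕ → Fin n → Matrix (Fin d) (Fin d) ℝ) (Q : ℕ → Matrix (Fin d) (Fin d) ℝ)
    (u : ℕ → Fin d → ℝ) : Prop where
  x_init : x 0 = x0
  z_init : ∀ i, z 0 i = x0
  D_init : ∀ i, D 0 i = (1 + α 0) ^ 2 • I0 i
  x_step : ∀ t, 1 ≤ t → (x t).ofLp =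
    (∑ i, D (t - 1) i)⁻¹.mulVec
      (∑ i, ((D (t - 1) i).mulVec (z (t - 1) i).ofLp - (gradient (f i) (z (t - 1) i)).ofLp))
  z_active : ∀ t, 1 ≤ t → z t (idx n t) = x t
  z_rest : ∀ t, 1 ≤ t → ∀ i, i ≠ idx n t → z t i = z (t - 1) i
  D_rest : ∀ t, 1 ≤ t → ∀ i, i ≠ idx n t → D t i = omega α n t • D (t - 1) i
  Q_step : ∀ t, 1 ≤ t → Q t =
    bfgs (D (t - 1) (idx n t))
      ((1 + α ⌈(t : ℝ) / n - 1⌉₊) •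
        avgHess (f (idx n t)) (z (t - 1) (idx n t)) (z t (idx n t)))
      (z t (idx n t) - z (t - 1) (idx n t)).ofLp
  u_greedy : ∀ t, 1 ≤ t → IsGreedy (Q t) (hess (f (idx n t)) (z t (idx n t))) (u t)
  D_active : ∀ t, 1 ≤ t → D t (idx n t) =
    omega α n t • bfgs (Q t) (hess (f (idx n t)) (z t (idx n t))) (u t)

end SLIQN

end

/-!
Write `H_i = ∇²f_i(z_i)`. If `(1 + a)² H_i ≤ D_i` and the next iterate `x` is close enough to `z_i`
that Hessians and averaged Hessians along the step agree up to the factor `1 + a`, then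
`∇²f_i(x) ≤ (1 + a) K ≤ D_i`, so both BFGS updates act on matrices lying above their targets and
the order survives. Scaling `D_i` by `(1 + a)²` and the first update together multiply `σ + d` by
at most `(1 + a)⁴`; the greedy second update then lowers `σ` by at least
`Tr(Q - ∇²f_i(x)) / (dL) ≥ μσ / (dL)`, that is, contracts it by `q = 1 - μ / (dL)`.

Comparing the step with a Newton step, `‖x - x⋆‖` is at most `(L b + Lt R) / μ` times the mean of
the `‖z_i - x⋆‖`, where `b` bounds all `σ(D_i, H_i)` and `R` all distances. Along epochs `p`, the
radius `R_p = ε ρ^p` and the error bound `m_p = c (2 q^p - ρ^p)` close the induction: since `ρ < q`,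
the slack `c (q - ρ) ρ^p` in `m_p` pays for the corrections `α_p ∼ ε ρ^p` once `ε` is small, and for
`c = μρ / (4L)`, `b_p = 2 c q^p` the factor `(L b_p + Lt R_p) / μ` is at most `q^(p+1)`.
-/

namespace SLIQN

open Matrix
open scoped MatrixOrder

section QuadraticForm

variable {ι : Type*} {A B E : Matrix ι ι ℝ}

lemma posDef_of_le (hA : A.PosDef) (hAB : A ≤ B) : B.PosDef := by
  simpa using hA.add_posSemidef (Matrix.le_iff.1 hAB)

lemma isHermitian_smul (hA : A.IsHermitian) (c : ℝ) : (c • A).IsHermitian :=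
  hA.smul (.all c)

variable [Fintype ι]

lemma dotProduct_mulVec_comm (hA : A.IsHermitian) (v w : ι → ℝ) :
    v ⬝ᵥ A *ᵥ w = w ⬝ᵥ A *ᵥ v := by
  have hAT : Aᵀ = A := by simpa using hA.eq
  rw [dotProduct_mulVec, ← mulVec_transpose, hAT, dotProduct_comm]

lemma dotProduct_mulVec_add_smul (hA : A.IsHermitian) (v w : ι → ℝ) (s : ℝ) :
    (v + s • w) ⬝ᵥ A *ᵥ (v + s • w) =
      v ⬝ᵥ A *ᵥ v + 2 * s * (w ⬝ᵥ A *ᵥ v) + s ^ 2 * (w ⬝ᵥ A *ᵥ w) := by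
  simp only [mulVec_add, mulVec_smul, dotProduct_add, add_dotProduct, dotProduct_smul,
    smul_dotProduct, smul_eq_mul, dotProduct_mulVec_comm hA v w]
  ring

lemma dotProduct_mulVec_pos (hA : A.PosDef) {v : ι → ℝ} (hv : v ≠ 0) : 0 < v ⬝ᵥ A *ᵥ v :=
  hA.dotProduct_mulVec_pos hv

lemma dotProduct_mulVec_le_of_le (hAB : A ≤ B) (v : ι → ℝ) :
    v ⬝ᵥ A *ᵥ v ≤ v ⬝ᵥ B *ᵥ v := by
  have hnonneg := (Matrix.le_iff.1 hAB).dotProduct_mulVec_nonneg v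
  rwa [star_trivial, sub_mulVec, dotProduct_sub, sub_nonneg] at hnonneg

lemma le_of_dotProduct_mulVec_le (hA : A.IsHermitian) (hB : B.IsHermitian)
    (h : ∀ v, v ⬝ᵥ A *ᵥ v ≤ v ⬝ᵥ B *ᵥ v) : A ≤ B := by
  refine Matrix.le_iff.2 (.of_dotProduct_mulVec_nonneg (hB.sub hA) fun v => ?_)
  rw [star_trivial, sub_mulVec, dotProduct_sub, sub_nonneg]
  exact h v

lemma dotProduct_mulVec_nonneg (hE : 0 ≤ E) (v : ι → ℝ) : 0 ≤ v ⬝ᵥ E *ᵥ v := by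
  simpa using dotProduct_mulVec_le_of_le hE v

lemma sq_dotProduct_mulVec_le (hE : 0 ≤ E) (v w : ι → ℝ) :
    (w ⬝ᵥ E *ᵥ v) ^ 2 ≤ (w ⬝ᵥ E *ᵥ w) * (v ⬝ᵥ E *ᵥ v) := by
  have hquad (s : ℝ) :
      0 ≤ (w ⬝ᵥ E *ᵥ w) * (s * s) + 2 * (w ⬝ᵥ E *ᵥ v) * s + v ⬝ᵥ E *ᵥ v := by
    have := dotProduct_mulVec_nonneg hE (v + s • w)
    rw [dotProduct_mulVec_add_smul (Matrix.nonneg_iff_posSemidef.1 hE).isHermitian] at this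
    linarith
  have hdiscrim := discrim_le_zero hquad
  rw [discrim] at hdiscrim
  linarith

lemma trace_mul_vecMulVec (v w : ι → ℝ) : (A * vecMulVec v w).trace = w ⬝ᵥ A *ᵥ v := by
  rw [mul_vecMulVec, trace_vecMulVec, dotProduct_comm]

lemma trace_mul_nonneg (hA : 0 ≤ A) (hB : 0 ≤ B) : 0 ≤ (A * B).trace := by
  classical
  obtain ⟨C, rfl⟩ : ∃ C : Matrix ι ι ℝ, B = Cᴴ * C :=
    CStarAlgebra.nonneg_iff_eq_star_mul_self.1 hB
  rw [← Matrix.mul_assoc, trace_mul_comm, ← Matrix.mul_assoc]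
  exact ((Matrix.nonneg_iff_posSemidef.1 hA).mul_mul_conjTranspose_same C).trace_nonneg

lemma dotProduct_ofLp_self (v : EuclideanSpace ℝ ι) : v.ofLp ⬝ᵥ v.ofLp = ‖v‖ ^ 2 := by
  rw [EuclideanSpace.real_norm_sq_eq]
  simp [dotProduct, sq]

variable [DecidableEq ι]

lemma dotProduct_smul_one_mulVec (c : ℝ) (v : ι → ℝ) :
    v ⬝ᵥ (c • (1 : Matrix ι ι ℝ)) *ᵥ v = c * (v ⬝ᵥ v) := by
  rw [smul_mulVec, one_mulVec, dotProduct_smul, smul_eq_mul]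

lemma mul_inv_mulVec (hA : A.PosDef) (v : ι → ℝ) : A *ᵥ A⁻¹ *ᵥ v = v := by
  rw [mulVec_mulVec, mul_nonsing_inv A ((isUnit_iff_isUnit_det A).1 hA.isUnit), one_mulVec]

/- Fenchel–Young: `A⁻¹` is the form conjugate to that of `A`. -/
lemma two_mul_dotProduct_le (hA : A.PosDef) (v w : ι → ℝ) :
    2 * (v ⬝ᵥ w) ≤ v ⬝ᵥ A⁻¹ *ᵥ v + w ⬝ᵥ A *ᵥ w := by
  have hnonneg := dotProduct_mulVec_nonneg hA.posSemidef.nonneg (A⁻¹ *ᵥ v + (-1 : ℝ) • w)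
  rw [dotProduct_mulVec_add_smul hA.isHermitian, mul_inv_mulVec hA, dotProduct_comm (A⁻¹ *ᵥ v) v,
    dotProduct_comm w v] at hnonneg
  linarith

lemma posDef_inv_le_inv (hA : A.PosDef) (hAB : A ≤ B) : B⁻¹ ≤ A⁻¹ := by
  have hB := posDef_of_le hA hAB
  refine le_of_dotProduct_mulVec_le hB.inv.isHermitian hA.inv.isHermitian fun v => ?_
  have hyoung := two_mul_dotProduct_le hA v (B⁻¹ *ᵥ v)
  have hform := dotProduct_mulVec_le_of_le hAB (B⁻¹ *ᵥ v)
  rw [mul_inv_mulVec hB, dotProduct_comm (B⁻¹ *ᵥ v) v] at hform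
  linarith

lemma inv_smul_of_posDef {c : ℝ} (hc : c ≠ 0) (hA : A.PosDef) : (c • A)⁻¹ = c⁻¹ • A⁻¹ :=
  inv_smul' (A := A) (Units.mk0 c hc) ((isUnit_iff_isUnit_det A).1 hA.isUnit)

lemma trace_inv_mul_le_of_le_smul {A' : Matrix ι ι ℝ} {c : ℝ} (hc : 0 < c) (hA : A.PosDef)
    (hAA' : A ≤ c • A') (hE : 0 ≤ E) : (A'⁻¹ * E).trace ≤ c * (A⁻¹ * E).trace := by
  have hA' : A'.PosDef := by
    simpa [smul_smul, hc.ne'] using (posDef_of_le hA hAA').smul (inv_pos.2 hc)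
  have hdiff := trace_mul_nonneg (sub_nonneg.2 (posDef_inv_le_inv hA hAA')) hE
  rwa [inv_smul_of_posDef hc.ne' hA', sub_mul, trace_sub, smul_mul, trace_smul, smul_eq_mul,
    sub_nonneg, inv_mul_le_iff₀ hc] at hdiff

lemma vecMulVec_self_le (v : ι → ℝ) : vecMulVec v v ≤ (v ⬝ᵥ v) • (1 : Matrix ι ι ℝ) := by
  refine le_of_dotProduct_mulVec_le (posSemidef_vecMulVec_self_star v).isHermitian
    (isHermitian_smul isHermitian_one _) fun w => ?_
  have hcs := sq_dotProduct_mulVec_le (zero_le_one (α := Matrix ι ι ℝ)) v w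
  simp only [one_mulVec] at hcs
  rw [dotProduct_smul_one_mulVec, vecMulVec_mulVec, op_smul_eq_smul, dotProduct_smul, smul_eq_mul,
    dotProduct_comm v w]
  linarith

lemma le_trace_smul_one (hE : 0 ≤ E) : E ≤ E.trace • (1 : Matrix ι ι ℝ) := by
  refine le_of_dotProduct_mulVec_le (Matrix.nonneg_iff_posSemidef.1 hE).isHermitian
    (isHermitian_smul isHermitian_one _) fun v => ?_
  have htrace := trace_mul_nonneg hE (sub_nonneg.2 (vecMulVec_self_le v))
  rw [mul_sub, trace_sub, trace_mul_vecMulVec, Matrix.mul_smul, trace_smul, mul_one, smul_eq_mul,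
    sub_nonneg] at htrace
  rwa [dotProduct_smul_one_mulVec, mul_comm]

lemma norm_toEuclideanCLM_le {c : ℝ} (hc : 0 ≤ c) (hE : 0 ≤ E) (hEc : E ≤ c • 1) :
    ‖toEuclideanCLM (𝕜 := ℝ) E‖ ≤ c := by
  refine ContinuousLinearMap.opNorm_le_bound _ hc fun v => ?_
  set w := toEuclideanCLM (𝕜 := ℝ) E v
  have hw : w.ofLp = E *ᵥ v.ofLp := rfl
  have hform (y : EuclideanSpace ℝ ι) : y.ofLp ⬝ᵥ E *ᵥ y.ofLp ≤ c * ‖y‖ ^ 2 := by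
    simpa [dotProduct_ofLp_self, smul_mulVec] using dotProduct_mulVec_le_of_le hEc y.ofLp
  have hsq : (‖w‖ ^ 2) ^ 2 ≤ ‖w‖ ^ 2 * (c * ‖v‖) ^ 2 := calc
    (‖w‖ ^ 2) ^ 2 = (w.ofLp ⬝ᵥ E *ᵥ v.ofLp) ^ 2 := by rw [← hw, dotProduct_ofLp_self]
    _ ≤ (w.ofLp ⬝ᵥ E *ᵥ w.ofLp) * (v.ofLp ⬝ᵥ E *ᵥ v.ofLp) := sq_dotProduct_mulVec_le hE _ _
    _ ≤ (c * ‖w‖ ^ 2) * (c * ‖v‖ ^ 2) :=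
      mul_le_mul (hform w) (hform v) (dotProduct_mulVec_nonneg hE _) (by positivity)
    _ = ‖w‖ ^ 2 * (c * ‖v‖) ^ 2 := by ring
  rcases (norm_nonneg w).eq_or_lt with hzero | hpos
  · rw [← hzero]; positivity
  · rw [sq (‖w‖ ^ 2)] at hsq
    exact le_of_sq_le_sq (le_of_mul_le_mul_left hsq (by positivity)) (by positivity)

lemma mul_norm_le_norm_toEuclideanCLM {c : ℝ} (hcA : c • 1 ≤ A) (v : EuclideanSpace ℝ ι) :
    c * ‖v‖ ≤ ‖toEuclideanCLM (𝕜 := ℝ) A v‖ := by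
  set w := toEuclideanCLM (𝕜 := ℝ) A v
  have hform := dotProduct_mulVec_le_of_le hcA v.ofLp
  have hinner : v.ofLp ⬝ᵥ A *ᵥ v.ofLp = inner ℝ w v := by
    rw [EuclideanSpace.inner_eq_star_dotProduct, star_trivial]
    rfl
  rw [dotProduct_smul_one_mulVec, dotProduct_ofLp_self, hinner] at hform
  have hcs := hform.trans (real_inner_le_norm w v)
  rcases (norm_nonneg v).eq_or_lt with hzero | hpos
  · rw [← hzero, mul_zero]
    exact norm_nonneg _
  · exact le_of_mul_le_mul_right (by linarith) hpos

lemma sum_mulVec_sub_of_eq_inv_mulVec {κ : Type*} [Fintype κ] {D : κ → Matrix ι ι ℝ}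
    (hD : (∑ i, D i).PosDef) {z g gs : κ → ι → ℝ} (hgs : ∑ i, gs i = 0) {x : ι → ℝ}
    (hx : x = (∑ i, D i)⁻¹ *ᵥ ∑ i, (D i *ᵥ z i - g i)) (xs : ι → ℝ) :
    (∑ i, D i) *ᵥ (x - xs) = ∑ i, (D i *ᵥ (z i - xs) - (g i - gs i)) := by
  simp only [hx, mulVec_sub, mul_inv_mulVec hD, sum_mulVec, Finset.sum_sub_distrib, hgs]
  abel

end QuadraticForm

section Bfgs

variable {d : ℕ} {A B : Matrix (Fin d) (Fin d) ℝ}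

lemma mul_vecMulVec_self_mul (hB : B.IsHermitian) (u : Fin d → ℝ) :
    B * vecMulVec u u * B = vecMulVec (B *ᵥ u) (B *ᵥ u) := by
  have hBT : Bᵀ = B := by simpa using hB.eq
  rw [mul_vecMulVec, vecMulVec_mul, ← mulVec_transpose, hBT]

lemma bfgs_zero (B A : Matrix (Fin d) (Fin d) ℝ) : bfgs B A 0 = B := by
  simp [bfgs]

lemma bfgs_isHermitian (hB : B.IsHermitian) (hA : A.IsHermitian) (u : Fin d → ℝ) :
    (bfgs B A u).IsHermitian := by
  have hrankOne (C : Matrix (Fin d) (Fin d) ℝ) : (vecMulVec (C *ᵥ u) (C *ᵥ u)).IsHermitian :=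
    (posSemidef_vecMulVec_self_star _).isHermitian
  rw [bfgs, mul_vecMulVec_self_mul hB, mul_vecMulVec_self_mul hA]
  exact (hB.sub (isHermitian_smul (hrankOne B) _)).add (isHermitian_smul (hrankOne A) _)

lemma dotProduct_bfgs_mulVec (hB : B.IsHermitian) (hA : A.IsHermitian) (u v : Fin d → ℝ) :
    v ⬝ᵥ bfgs B A u *ᵥ v = v ⬝ᵥ B *ᵥ v - (u ⬝ᵥ B *ᵥ u)⁻¹ * (u ⬝ᵥ B *ᵥ v) ^ 2 +
      (u ⬝ᵥ A *ᵥ u)⁻¹ * (u ⬝ᵥ A *ᵥ v) ^ 2 := by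
  have hrankOne {C : Matrix (Fin d) (Fin d) ℝ} (hC : C.IsHermitian) :
      v ⬝ᵥ vecMulVec (C *ᵥ u) (C *ᵥ u) *ᵥ v = (u ⬝ᵥ C *ᵥ v) ^ 2 := by
    rw [vecMulVec_mulVec, op_smul_eq_smul, dotProduct_smul, smul_eq_mul, dotProduct_comm (C *ᵥ u),
      dotProduct_mulVec_comm hC v u, sq]
  rw [bfgs, mul_vecMulVec_self_mul hB, mul_vecMulVec_self_mul hA, add_mulVec, sub_mulVec,
    smul_mulVec, smul_mulVec, dotProduct_add, dotProduct_sub, dotProduct_smul, dotProduct_smul,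
    hrankOne hB, hrankOne hA, smul_eq_mul, smul_eq_mul]

/- Minimizing the form of `A` along the line `v + ℝ u` subtracts `(u ⬝ A v)² / (u ⬝ A u)`. -/
lemma dotProduct_mulVec_add_smul_of_posDef (hA : A.PosDef) {u : Fin d → ℝ} (hu : u ≠ 0)
    (v : Fin d → ℝ) (s : ℝ) :
    (v + s • u) ⬝ᵥ A *ᵥ (v + s • u) = v ⬝ᵥ A *ᵥ v - (u ⬝ᵥ A *ᵥ u)⁻¹ * (u ⬝ᵥ A *ᵥ v) ^ 2 +
      (u ⬝ᵥ A *ᵥ u) * (s + (u ⬝ᵥ A *ᵥ u)⁻¹ * (u ⬝ᵥ A *ᵥ v)) ^ 2 := by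
  have hne := (dotProduct_mulVec_pos hA hu).ne'
  rw [dotProduct_mulVec_add_smul hA.isHermitian]
  field_simp
  ring

lemma le_bfgs (hA : A.PosDef) (hAB : A ≤ B) (u : Fin d → ℝ) : A ≤ bfgs B A u := by
  rcases eq_or_ne u 0 with rfl | hu
  · rwa [bfgs_zero]
  have hB := posDef_of_le hA hAB
  refine le_of_dotProduct_mulVec_le hA.isHermitian
    (bfgs_isHermitian hB.isHermitian hA.isHermitian u) fun v => ?_
  have hline := dotProduct_mulVec_le_of_le hAB (v + (-((u ⬝ᵥ B *ᵥ u)⁻¹ * (u ⬝ᵥ B *ᵥ v))) • u)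
  rw [dotProduct_mulVec_add_smul_of_posDef hA hu, dotProduct_mulVec_add_smul_of_posDef hB hu,
    neg_add_cancel] at hline
  rw [dotProduct_bfgs_mulVec hB.isHermitian hA.isHermitian]
  have hAu := dotProduct_mulVec_pos hA hu
  have hsq : 0 ≤ (u ⬝ᵥ A *ᵥ u) *
      (-((u ⬝ᵥ B *ᵥ u)⁻¹ * (u ⬝ᵥ B *ᵥ v)) + (u ⬝ᵥ A *ᵥ u)⁻¹ * (u ⬝ᵥ A *ᵥ v)) ^ 2 := by
    positivity
  linarith

lemma trace_inv_mul_bfgs (hB : B.IsHermitian) (hA : A.PosDef) {u : Fin d → ℝ} (hu : u ≠ 0) :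
    (A⁻¹ * bfgs B A u).trace = (A⁻¹ * B).trace -
      ((u ⬝ᵥ B *ᵥ u)⁻¹ * ((B *ᵥ u) ⬝ᵥ A⁻¹ *ᵥ (B *ᵥ u)) - 1) := by
  have hdet : IsUnit A.det := (isUnit_iff_isUnit_det A).1 hA.isUnit
  rw [bfgs, mul_vecMulVec_self_mul hB, mul_vecMulVec_self_mul hA.isHermitian]
  simp only [mul_add, mul_sub, Matrix.mul_smul, trace_add, trace_sub, trace_smul,
    trace_mul_vecMulVec, smul_eq_mul]
  rw [mulVec_mulVec u A⁻¹ A, nonsing_inv_mul A hdet, one_mulVec, dotProduct_comm (A *ᵥ u) u,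
    inv_mul_cancel₀ (dotProduct_mulVec_pos hA hu).ne']
  ring

lemma sigma_eq_trace (hA : A.PosDef) : sigma B A = (A⁻¹ * (B - A)).trace := by
  have hAT : (A⁻¹)ᵀ = A⁻¹ := by simpa using hA.inv.isHermitian.eq
  rw [sigma, hAT]

lemma sigma_add_dim (hA : A.PosDef) : sigma B A + d = (A⁻¹ * B).trace := by
  have hdet : IsUnit A.det := (isUnit_iff_isUnit_det A).1 hA.isUnit
  rw [sigma_eq_trace hA, mul_sub, trace_sub, nonsing_inv_mul A hdet, trace_one, Fintype.card_fin,
    sub_add_cancel]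

lemma sigma_smul_add_dim (hA : A.PosDef) (c : ℝ) :
    sigma (c • B) A + d = c * (sigma B A + d) := by
  rw [sigma_add_dim hA, sigma_add_dim hA, Matrix.mul_smul, trace_smul, smul_eq_mul]

lemma sigma_add_dim_le_of_le_smul {A' : Matrix (Fin d) (Fin d) ℝ} {c : ℝ} (hc : 0 < c)
    (hA : A.PosDef) (hA' : A'.PosDef) (hAA' : A ≤ c • A') (hB : 0 ≤ B) :
    sigma B A' + d ≤ c * (sigma B A + d) := by
  rw [sigma_add_dim hA, sigma_add_dim hA']
  exact trace_inv_mul_le_of_le_smul hc hA hAA' hB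

lemma trace_sub_le_mul_sigma {L : ℝ} (hL : 0 < L) (hA : A.PosDef) (hAL : A ≤ L • 1)
    (hAB : A ≤ B) : (B - A).trace ≤ L * sigma B A := by
  have htrace := trace_inv_mul_le_of_le_smul hL hA hAL (sub_nonneg.2 hAB)
  rwa [← sigma_eq_trace hA, inv_one, one_mul] at htrace

lemma mul_sigma_le_trace_sub {μ : ℝ} (hμ : 0 < μ) (hμA : μ • 1 ≤ A) (hAB : A ≤ B) :
    μ * sigma B A ≤ (B - A).trace := by
  have hA := posDef_of_le (PosDef.one.smul hμ) hμA
  have hone : 1 ≤ μ⁻¹ • A := by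
    simpa [smul_smul, hμ.ne'] using smul_le_smul_of_nonneg_left hμA (inv_nonneg.2 hμ.le)
  have htrace := trace_inv_mul_le_of_le_smul (inv_pos.2 hμ) PosDef.one hone (sub_nonneg.2 hAB)
  rwa [← sigma_eq_trace hA, inv_one, one_mul, le_inv_mul_iff₀ hμ] at htrace

lemma le_sub_sigma_bfgs (hA : A.PosDef) (hB : B.PosDef) {u : Fin d → ℝ} (hu : u ≠ 0) :
    (u ⬝ᵥ B *ᵥ u) / (u ⬝ᵥ A *ᵥ u) - 1 ≤ sigma B A - sigma (bfgs B A u) A := by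
  set θ := (u ⬝ᵥ B *ᵥ u) / (u ⬝ᵥ A *ᵥ u)
  have hBu := dotProduct_mulVec_pos hB hu
  have hθ : θ * (u ⬝ᵥ A *ᵥ u) = u ⬝ᵥ B *ᵥ u := div_mul_cancel₀ _ (dotProduct_mulVec_pos hA hu).ne'
  have hyoung := two_mul_dotProduct_le hA (B *ᵥ u) (θ • u)
  simp only [mulVec_smul, dotProduct_smul, smul_dotProduct, smul_eq_mul, hθ,
    dotProduct_comm (B *ᵥ u) u] at hyoung
  have hdrop : θ ≤ (u ⬝ᵥ B *ᵥ u)⁻¹ * ((B *ᵥ u) ⬝ᵥ A⁻¹ *ᵥ (B *ᵥ u)) := by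
    rw [le_inv_mul_iff₀ hBu]
    linarith
  have htrace := trace_inv_mul_bfgs hB.isHermitian hA hu
  rw [← sigma_add_dim hA, ← sigma_add_dim hA] at htrace
  linarith

lemma sigma_bfgs_le (hA : A.PosDef) (hAB : A ≤ B) (u : Fin d → ℝ) :
    sigma (bfgs B A u) A ≤ sigma B A := by
  rcases eq_or_ne u 0 with rfl | hu
  · rw [bfgs_zero]
  have hratio : 1 ≤ (u ⬝ᵥ B *ᵥ u) / (u ⬝ᵥ A *ᵥ u) :=
    (one_le_div (dotProduct_mulVec_pos hA hu)).2 (dotProduct_mulVec_le_of_le hAB u)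
  linarith [le_sub_sigma_bfgs hA (posDef_of_le hA hAB) hu]

lemma IsGreedy.ne_zero {u : Fin d → ℝ} (hu : IsGreedy B A u) : u ≠ 0 := by
  obtain ⟨⟨k, rfl⟩, -⟩ := hu
  simp

lemma IsGreedy.trace_sub_le {L : ℝ} (hA : A.PosDef) (hAL : A ≤ L • 1) (hAB : A ≤ B)
    {u : Fin d → ℝ} (hu : IsGreedy B A u) :
    (B - A).trace ≤ d * L * ((u ⬝ᵥ B *ᵥ u) / (u ⬝ᵥ A *ᵥ u) - 1) := by
  set θ := (u ⬝ᵥ B *ᵥ u) / (u ⬝ᵥ A *ᵥ u)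
  have hθ : 1 ≤ θ :=
    (one_le_div (dotProduct_mulVec_pos hA hu.ne_zero)).2 (dotProduct_mulVec_le_of_le hAB u)
  have hdiag (i : Fin d) : (B - A) i i ≤ L * (θ - 1) := by
    have hi : (Pi.single i 1 : Fin d → ℝ) ≠ 0 := by simp
    have hmax : _ / _ ≤ θ := hu.2 (Set.mem_range_self i)
    have hLi := dotProduct_mulVec_le_of_le hAL (Pi.single i 1)
    rw [dotProduct_smul_one_mulVec] at hLi
    rw [div_le_iff₀ (dotProduct_mulVec_pos hA hi)] at hmax
    simp only [mulVec_single_one, single_one_dotProduct, col_apply, Pi.single_eq_same, mul_one]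
      at hmax hLi
    rw [Matrix.sub_apply]
    nlinarith
  calc (B - A).trace = ∑ i, (B - A) i i := rfl
    _ ≤ ∑ _i : Fin d, L * (θ - 1) := Finset.sum_le_sum fun i _ => hdiag i
    _ = d * L * (θ - 1) := by simp [mul_assoc]

lemma IsGreedy.sigma_bfgs_le {μ L : ℝ} (hμ : 0 < μ) (hL : 0 < L) (hμA : μ • 1 ≤ A)
    (hAL : A ≤ L • 1) (hAB : A ≤ B) {u : Fin d → ℝ} (hu : IsGreedy B A u) :
    sigma (bfgs B A u) A ≤ (1 - μ / (d * L)) * sigma B A := by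
  have hd : (0 : ℝ) < d := by
    obtain ⟨⟨k, -⟩, -⟩ := hu
    exact_mod_cast k.pos
  have hA := posDef_of_le (PosDef.one.smul hμ) hμA
  have hdrop := le_sub_sigma_bfgs hA (posDef_of_le hA hAB) hu.ne_zero
  have htrace := (mul_sigma_le_trace_sub hμ hμA hAB).trans (hu.trace_sub_le hA hAL hAB)
  have hratio : μ / (d * L) * sigma B A ≤ (u ⬝ᵥ B *ᵥ u) / (u ⬝ᵥ A *ᵥ u) - 1 := by
    rw [div_mul_eq_mul_div, div_le_iff₀ (by positivity)]
    linarith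
  linarith

end Bfgs

section Gradient

variable {E : Type*} [NormedAddCommGroup E]

lemma norm_sub_sub_fderiv_le [NormedSpace ℝ E] {F : Type*} [NormedAddCommGroup F]
    [NormedSpace ℝ F] {g : E → F} (hg : Differentiable ℝ g) {K : ℝ} (hK : 0 ≤ K) {x : E}
    (hlip : ∀ y, ‖fderiv ℝ g y - fderiv ℝ g x‖ ≤ K * ‖y - x‖) (y : E) :
    ‖g y - g x - fderiv ℝ g x (y - x)‖ ≤ K * ‖y - x‖ ^ 2 := by
  rw [sq, ← mul_assoc]
  refine (convex_segment x y).norm_image_sub_le_of_norm_fderiv_le' (fun z _ => hg z)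
    (fun z hz => (hlip z).trans ?_) (left_mem_segment ℝ x y) (right_mem_segment ℝ x y)
  gcongr
  obtain ⟨θ, hθ, rfl⟩ := (segment_eq_image' ℝ x y ▸ hz)
  rw [add_sub_cancel_left, norm_smul, Real.norm_of_nonneg hθ.1]
  exact mul_le_of_le_one_left (norm_nonneg _) hθ.2

variable [InnerProductSpace ℝ E] {f : E → ℝ}

lemma mul_norm_sq_le_inner_fderiv {g : E → E} {x : E} (hg : DifferentiableAt ℝ g x) {c : ℝ}
    (hmono : ∀ y, c * ‖y - x‖ ^ 2 ≤ inner ℝ (g y - g x) (y - x)) (v : E) :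
    c * ‖v‖ ^ 2 ≤ inner ℝ (fderiv ℝ g x v) v := by
  have hline : HasDerivAt (fun s : ℝ => g (x + s • v)) (fderiv ℝ g x v) 0 := by
    have hlin : HasDerivAt (fun s : ℝ => x + s • v) v 0 := by
      simpa using ((hasDerivAt_id (0 : ℝ)).smul_const v).const_add x
    exact HasFDerivAt.comp_hasDerivAt (0 : ℝ) (by simpa using hg.hasFDerivAt) hlin
  have hinner := hline.inner ℝ (hasDerivAt_const (0 : ℝ) v)
  rw [hasDerivAt_iff_tendsto_slope, inner_zero_right, zero_add] at hinner
  refine ge_of_tendsto hinner ?_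
  filter_upwards [self_mem_nhdsWithin] with s (hs : s ≠ 0)
  have hxs := hmono (x + s • v)
  rw [add_sub_cancel_left, inner_smul_right, norm_smul, mul_pow, Real.norm_eq_abs, sq_abs] at hxs
  rw [slope_def_field, zero_smul, add_zero, ← inner_sub_left, sub_zero]
  refine le_of_mul_le_mul_left ?_ (pow_pos (abs_pos.2 hs) 2)
  rw [sq_abs]
  calc s ^ 2 * (c * ‖v‖ ^ 2) = c * (s ^ 2 * ‖v‖ ^ 2) := by ring
    _ ≤ s * inner ℝ (g (x + s • v) - g x) v := hxs
    _ = s ^ 2 * (inner ℝ (g (x + s • v) - g x) v / s) := by field_simp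

variable [CompleteSpace E]

lemma contDiff_gradient (hf : ContDiff ℝ 2 f) : ContDiff ℝ 1 (gradient f) :=
  (LinearIsometryEquiv.contDiff _).comp (hf.fderiv_right (m := 1) (by norm_num))

lemma inner_fderiv_gradient (f : E → ℝ) (x v w : E) :
    inner ℝ (fderiv ℝ (gradient f) x w) v = fderiv ℝ (fderiv ℝ f) x w v := by
  have hcomp : gradient f = (InnerProductSpace.toDual ℝ E).symm ∘ fderiv ℝ f := rfl
  rw [hcomp, LinearIsometryEquiv.comp_fderiv']
  exact InnerProductSpace.toDual_symm_apply

lemma inner_fderiv_gradient_comm (hf : ContDiff ℝ 2 f) (x v w : E) :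
    inner ℝ (fderiv ℝ (gradient f) x w) v = inner ℝ (fderiv ℝ (gradient f) x v) w := by
  rw [inner_fderiv_gradient, inner_fderiv_gradient]
  exact (hf.contDiffAt.isSymmSndFDerivAt (by simp)).eq w v

lemma sum_gradient_eq_zero {ι : Type*} [Fintype ι] {f : ι → E → ℝ} {x : E}
    (hf : ∀ i, DifferentiableAt ℝ (f i) x) {c : ℝ} (hc : c ≠ 0)
    (hmin : IsLocalMin (fun y => c * ∑ i, f i y) x) : ∑ i, gradient (f i) x = 0 := by
  have hderiv := hmin.fderiv_eq_zero
  rw [fderiv_const_mul (DifferentiableAt.fun_sum fun i _ => hf i),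
    fderiv_fun_sum fun i _ => hf i, smul_eq_zero_iff_right hc] at hderiv
  simp only [gradient, ← map_sum, hderiv, map_zero]

end Gradient

section Hessian

variable {d : ℕ} {f : EuclideanSpace ℝ (Fin d) → ℝ} {μ L Lt : ℝ}

lemma hess_mulVec (f : EuclideanSpace ℝ (Fin d) → ℝ) (x v : EuclideanSpace ℝ (Fin d)) :
    hess f x *ᵥ v.ofLp = (hessOp f x v).ofLp := by
  rw [← ofLp_toEuclideanCLM, hess, StarAlgEquiv.apply_symm_apply]

lemma dotProduct_hess_mulVec (f : EuclideanSpace ℝ (Fin d) → ℝ)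
    (x v w : EuclideanSpace ℝ (Fin d)) :
    v.ofLp ⬝ᵥ hess f x *ᵥ w.ofLp = inner ℝ (hessOp f x w) v := by
  rw [hess_mulVec, EuclideanSpace.inner_eq_star_dotProduct, star_trivial]

lemma hess_apply (f : EuclideanSpace ℝ (Fin d) → ℝ) (x : EuclideanSpace ℝ (Fin d))
    (i j : Fin d) : hess f x i j = inner ℝ (hessOp f x (EuclideanSpace.single j 1))
      (EuclideanSpace.single i 1) := by
  rw [← dotProduct_hess_mulVec]
  simp

lemma hess_isHermitian (hf : ContDiff ℝ 2 f) (x : EuclideanSpace ℝ (Fin d)) :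
    (hess f x).IsHermitian := by
  ext i j
  rw [conjTranspose_apply, star_trivial, hess_apply, hess_apply, hessOp,
    inner_fderiv_gradient_comm hf]

lemma continuous_hess_apply (hf : ContDiff ℝ 2 f) (i j : Fin d) :
    Continuous fun x => hess f x i j := by
  simp only [hess_apply, hessOp]
  have := (contDiff_gradient hf).continuous_fderiv one_ne_zero
  fun_prop

lemma smul_one_le_hess (hf : ContDiff ℝ 2 f) (hconv : StronglyConvex μ f)
    (x : EuclideanSpace ℝ (Fin d)) : μ • 1 ≤ hess f x := by
  refine le_of_dotProduct_mulVec_le (isHermitian_smul isHermitian_one _) (hess_isHermitian hf x)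
    fun v => ?_
  rw [dotProduct_smul_one_mulVec, dotProduct_ofLp_self (WithLp.toLp 2 v),
    dotProduct_hess_mulVec f x (WithLp.toLp 2 v) (WithLp.toLp 2 v)]
  refine mul_norm_sq_le_inner_fderiv ((contDiff_gradient hf).differentiable one_ne_zero x)
    (fun y => ?_) _
  have hxy := hconv x y
  have hyx := hconv y x
  rw [norm_sub_rev x y, ← neg_sub y x, inner_neg_right] at hyx
  rw [inner_sub_left]
  linarith

lemma hess_le_smul_one (hf : ContDiff ℝ 2 f) (hsmooth : Smooth L f)
    (x : EuclideanSpace ℝ (Fin d)) : hess f x ≤ L • 1 := by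
  refine le_of_dotProduct_mulVec_le (hess_isHermitian hf x) (isHermitian_smul isHermitian_one _)
    fun v => ?_
  rw [dotProduct_smul_one_mulVec, dotProduct_ofLp_self (WithLp.toLp 2 v),
    dotProduct_hess_mulVec f x (WithLp.toLp 2 v) (WithLp.toLp 2 v)]
  have hneg := mul_norm_sq_le_inner_fderiv (g := -gradient f) (c := -L) (x := x)
    ((contDiff_gradient hf).differentiable one_ne_zero x).neg (fun y => ?_) (WithLp.toLp 2 v)
  · rwa [fderiv_neg, _root_.neg_apply, inner_neg_left, neg_mul, neg_le_neg_iff] at hneg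
  · have hxy := hsmooth x y
    have hyx := hsmooth y x
    rw [norm_sub_rev x y, ← neg_sub y x, inner_neg_right] at hyx
    simp only [Pi.neg_apply, inner_sub_left, inner_neg_left]
    linarith

lemma hess_le_hess_add (hf : ContDiff ℝ 2 f) (hlip : LipschitzHessian Lt f)
    (x y : EuclideanSpace ℝ (Fin d)) : hess f y ≤ hess f x + (Lt * ‖y - x‖) • 1 := by
  refine le_of_dotProduct_mulVec_le (hess_isHermitian hf y)
    ((hess_isHermitian hf x).add (isHermitian_smul isHermitian_one _)) fun v => ?_
  set w : EuclideanSpace ℝ (Fin d) := WithLp.toLp 2 v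
  have hw : v = w.ofLp := rfl
  rw [add_mulVec, dotProduct_add, dotProduct_smul_one_mulVec, hw, dotProduct_hess_mulVec,
    dotProduct_hess_mulVec, dotProduct_ofLp_self, ← sub_le_iff_le_add', ← inner_sub_left,
    ← _root_.sub_apply]
  calc inner ℝ ((hessOp f y - hessOp f x) w) w ≤ ‖(hessOp f y - hessOp f x) w‖ * ‖w‖ :=
        real_inner_le_norm _ _
    _ ≤ Lt * ‖y - x‖ * ‖w‖ * ‖w‖ := by
        gcongr
        exact ContinuousLinearMap.le_of_opNorm_le _ (hlip x y) w
    _ = Lt * ‖y - x‖ * ‖w‖ ^ 2 := by ring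

lemma avgHess_comm (f : EuclideanSpace ℝ (Fin d) → ℝ) (x y : EuclideanSpace ℝ (Fin d)) :
    avgHess f x y = avgHess f y x := by
  ext i j
  have hflip (τ : ℝ) : x + (1 - τ) • (y - x) = y + τ • (x - y) := by module
  simpa [avgHess, hflip] using (intervalIntegral.integral_comp_sub_left
    (fun τ : ℝ => hess f (x + τ • (y - x)) i j) (1 : ℝ) (a := 0) (b := 1)).symm

lemma avgHess_isHermitian (hf : ContDiff ℝ 2 f) (x y : EuclideanSpace ℝ (Fin d)) :
    (avgHess f x y).IsHermitian := by
  ext i j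
  rw [conjTranspose_apply, star_trivial]
  simp only [avgHess, of_apply]
  congr! 2 with τ
  simpa using (hess_isHermitian hf (x + τ • (y - x))).apply i j

lemma dotProduct_mulVec_eq_sum {ι : Type*} [Fintype ι] (A : Matrix ι ι ℝ) (v : ι → ℝ) :
    v ⬝ᵥ A *ᵥ v = ∑ i, ∑ j, A i j * (v i * v j) := by
  simp only [dotProduct, mulVec, Finset.mul_sum, mul_left_comm]

lemma continuous_dotProduct_hess_mulVec (hf : ContDiff ℝ 2 f) (x y : EuclideanSpace ℝ (Fin d))
    (v : Fin d → ℝ) : Continuous fun τ : ℝ => v ⬝ᵥ hess f (x + τ • (y - x)) *ᵥ v := by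
  simp only [dotProduct_mulVec_eq_sum]
  have := continuous_hess_apply hf
  fun_prop

lemma dotProduct_avgHess_mulVec (hf : ContDiff ℝ 2 f) (x y : EuclideanSpace ℝ (Fin d))
    (v : Fin d → ℝ) :
    v ⬝ᵥ avgHess f x y *ᵥ v = ∫ τ in (0 : ℝ)..1, v ⬝ᵥ hess f (x + τ • (y - x)) *ᵥ v := by
  have hcont := continuous_hess_apply hf
  simp only [dotProduct_mulVec_eq_sum]
  rw [intervalIntegral.integral_finsetSum fun i _ =>
    Continuous.intervalIntegrable (by fun_prop) _ _]
  refine Finset.sum_congr rfl fun i _ => ?_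
  rw [intervalIntegral.integral_finsetSum fun j _ =>
    Continuous.intervalIntegrable (by fun_prop) _ _]
  simp only [intervalIntegral.integral_mul_const]
  rfl

lemma integral_dotProduct_add_smul_mulVec (A B : Matrix (Fin d) (Fin d) ℝ) (v : Fin d → ℝ) :
    ∫ τ in (0 : ℝ)..1, v ⬝ᵥ (A + τ • B) *ᵥ v = v ⬝ᵥ (A + (1 / 2 : ℝ) • B) *ᵥ v := by
  simp only [add_mulVec, smul_mulVec, dotProduct_add, dotProduct_smul, smul_eq_mul]
  rw [intervalIntegral.integral_add (by simp) (Continuous.intervalIntegrable (by fun_prop) _ _),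
    intervalIntegral.integral_mul_const]
  simp

lemma avgHess_le (hf : ContDiff ℝ 2 f) {x y : EuclideanSpace ℝ (Fin d)}
    {A B : Matrix (Fin d) (Fin d) ℝ} (hA : A.IsHermitian) (hB : B.IsHermitian)
    (h : ∀ τ ∈ Set.Icc (0 : ℝ) 1, hess f (x + τ • (y - x)) ≤ A + τ • B) :
    avgHess f x y ≤ A + (1 / 2 : ℝ) • B := by
  refine le_of_dotProduct_mulVec_le (avgHess_isHermitian hf x y)
    (hA.add (isHermitian_smul hB _)) fun v => ?_
  rw [dotProduct_avgHess_mulVec hf, ← integral_dotProduct_add_smul_mulVec]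
  refine intervalIntegral.integral_mono_on zero_le_one
    ((continuous_dotProduct_hess_mulVec hf x y v).intervalIntegrable _ _)
    (Continuous.intervalIntegrable ?_ _ _) fun τ hτ => dotProduct_mulVec_le_of_le (h τ hτ) v
  simp only [dotProduct_mulVec_eq_sum, Matrix.add_apply, Matrix.smul_apply]
  fun_prop

lemma le_avgHess (hf : ContDiff ℝ 2 f) {x y : EuclideanSpace ℝ (Fin d)}
    {A B : Matrix (Fin d) (Fin d) ℝ} (hA : A.IsHermitian) (hB : B.IsHermitian)
    (h : ∀ τ ∈ Set.Icc (0 : ℝ) 1, A + τ • B ≤ hess f (x + τ • (y - x))) :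
    A + (1 / 2 : ℝ) • B ≤ avgHess f x y := by
  refine le_of_dotProduct_mulVec_le (hA.add (isHermitian_smul hB _))
    (avgHess_isHermitian hf x y) fun v => ?_
  rw [dotProduct_avgHess_mulVec hf, ← integral_dotProduct_add_smul_mulVec]
  refine intervalIntegral.integral_mono_on zero_le_one (Continuous.intervalIntegrable ?_ _ _)
    ((continuous_dotProduct_hess_mulVec hf x y v).intervalIntegrable _ _)
    fun τ hτ => dotProduct_mulVec_le_of_le (h τ hτ) v
  simp only [dotProduct_mulVec_eq_sum, Matrix.add_apply, Matrix.smul_apply]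
  fun_prop

lemma smul_one_le_avgHess (hf : ContDiff ℝ 2 f) (hconv : StronglyConvex μ f)
    (x y : EuclideanSpace ℝ (Fin d)) : μ • 1 ≤ avgHess f x y := by
  simpa using le_avgHess hf (isHermitian_smul isHermitian_one μ) isHermitian_zero fun τ _ => by
    simpa using smul_one_le_hess hf hconv (x + τ • (y - x))

lemma avgHess_le_smul_hess (hf : ContDiff ℝ 2 f) (hconv : StronglyConvex μ f)
    (hlip : LipschitzHessian Lt f) {x y : EuclideanSpace ℝ (Fin d)} {a : ℝ} (ha : 0 ≤ a)
    (hxy : Lt * ‖y - x‖ ≤ 2 * (a * μ)) : avgHess f x y ≤ (1 + a) • hess f x := by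
  have hτ (τ : ℝ) (hτ : τ ∈ Set.Icc (0 : ℝ) 1) :
      hess f (x + τ • (y - x)) ≤ hess f x + τ • (Lt * ‖y - x‖) • 1 := by
    convert hess_le_hess_add hf hlip x (x + τ • (y - x)) using 2
    rw [add_sub_cancel_left, norm_smul, Real.norm_of_nonneg hτ.1, smul_smul, mul_left_comm]
  calc avgHess f x y ≤ hess f x + (1 / 2 : ℝ) • (Lt * ‖y - x‖) • 1 :=
        avgHess_le hf (hess_isHermitian hf x) (isHermitian_smul isHermitian_one _) hτ
    _ ≤ hess f x + a • μ • (1 : Matrix (Fin d) (Fin d) ℝ) := by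
        rw [smul_smul, smul_smul]
        exact add_le_add_right (smul_le_smul_of_nonneg_right (by linarith) zero_le_one) _
    _ ≤ hess f x + a • hess f x := by
        gcongr
        exact smul_one_le_hess hf hconv x
    _ = (1 + a) • hess f x := by rw [add_smul, one_smul]

lemma hess_le_smul_avgHess (hf : ContDiff ℝ 2 f) (hconv : StronglyConvex μ f)
    (hlip : LipschitzHessian Lt f) {x y : EuclideanSpace ℝ (Fin d)} {a : ℝ} (ha : 0 ≤ a)
    (hxy : Lt * ‖y - x‖ ≤ 2 * (a * μ)) : hess f x ≤ (1 + a) • avgHess f x y := by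
  have hτ (τ : ℝ) (hτ : τ ∈ Set.Icc (0 : ℝ) 1) :
      hess f x + τ • -((Lt * ‖y - x‖) • 1) ≤ hess f (x + τ • (y - x)) := by
    rw [smul_neg, ← sub_eq_add_neg, sub_le_iff_le_add]
    convert hess_le_hess_add hf hlip (x + τ • (y - x)) x using 2
    rw [← norm_neg (x - _), neg_sub, add_sub_cancel_left, norm_smul, Real.norm_of_nonneg hτ.1,
      smul_smul, mul_left_comm]
  calc hess f x = hess f x + (1 / 2 : ℝ) • -((Lt * ‖y - x‖) • 1) + (Lt * ‖y - x‖ / 2) • 1 := by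
        module
    _ ≤ avgHess f x y + a • μ • 1 := by
        rw [smul_smul]
        exact add_le_add (le_avgHess hf (hess_isHermitian hf x)
          (isHermitian_smul isHermitian_one _).neg hτ) (smul_le_smul_of_nonneg_right (by linarith)
            zero_le_one)
    _ ≤ avgHess f x y + a • avgHess f x y := by
        gcongr
        exact smul_one_le_avgHess hf hconv x y
    _ = (1 + a) • avgHess f x y := by rw [add_smul, one_smul]

end Hessian

section Update

variable {d : ℕ} {f : EuclideanSpace ℝ (Fin d) → ℝ} {μ L Lt : ℝ}

lemma posDef_hess (hμ : 0 < μ) (hf : ContDiff ℝ 2 f) (hconv : StronglyConvex μ f)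
    (x : EuclideanSpace ℝ (Fin d)) : (hess f x).PosDef :=
  posDef_of_le (PosDef.one.smul hμ) (smul_one_le_hess hf hconv x)

lemma posDef_avgHess (hμ : 0 < μ) (hf : ContDiff ℝ 2 f) (hconv : StronglyConvex μ f)
    (x y : EuclideanSpace ℝ (Fin d)) : (avgHess f x y).PosDef :=
  posDef_of_le (PosDef.one.smul hμ) (smul_one_le_avgHess hf hconv x y)

section Secant

variable {x y : EuclideanSpace ℝ (Fin d)} {D : Matrix (Fin d) (Fin d) ℝ} {a : ℝ}

lemma smul_avgHess_le_of_le (hf : ContDiff ℝ 2 f) (hconv : StronglyConvex μ f)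
    (hlip : LipschitzHessian Lt f) (ha : 0 ≤ a) (hxy : Lt * ‖y - x‖ ≤ 2 * (a * μ))
    (hD : (1 + a) ^ 2 • hess f x ≤ D) : (1 + a) • avgHess f x y ≤ D := by
  refine le_trans ?_ hD
  rw [sq, mul_smul]
  exact smul_le_smul_of_nonneg_left (avgHess_le_smul_hess hf hconv hlip ha hxy) (by positivity)

lemma hess_le_bfgs_avgHess (hμ : 0 < μ) (hf : ContDiff ℝ 2 f) (hconv : StronglyConvex μ f)
    (hlip : LipschitzHessian Lt f) (ha : 0 ≤ a) (hxy : Lt * ‖y - x‖ ≤ 2 * (a * μ))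
    (hD : (1 + a) ^ 2 • hess f x ≤ D) (v : Fin d → ℝ) :
    hess f y ≤ bfgs D ((1 + a) • avgHess f x y) v := by
  have hK := (posDef_avgHess hμ hf hconv x y).smul (show 0 < 1 + a by positivity)
  have hlower := hess_le_smul_avgHess hf hconv hlip ha (by rwa [norm_sub_rev] at hxy)
  rw [avgHess_comm] at hlower
  exact hlower.trans (le_bfgs hK (smul_avgHess_le_of_le hf hconv hlip ha hxy hD) v)

lemma sigma_bfgs_avgHess_add_dim_le (hμ : 0 < μ) (hf : ContDiff ℝ 2 f)
    (hconv : StronglyConvex μ f) (hlip : LipschitzHessian Lt f) (ha : 0 ≤ a)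
    (hxy : Lt * ‖y - x‖ ≤ 2 * (a * μ)) (hD : (1 + a) ^ 2 • hess f x ≤ D) (v : Fin d → ℝ) :
    sigma (bfgs D ((1 + a) • avgHess f x y) v) (hess f y) + d ≤
      (1 + a) ^ 2 * (sigma D (hess f x) + d) := by
  set K := (1 + a) • avgHess f x y
  have hpos : 0 < 1 + a := by positivity
  have hH := posDef_hess hμ hf hconv
  have hK : K.PosDef := (posDef_avgHess hμ hf hconv x y).smul hpos
  have hKD : K ≤ D := smul_avgHess_le_of_le hf hconv hlip ha hxy hD
  have hHK : hess f x ≤ (1 : ℝ) • K := by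
    rw [one_smul]
    exact hess_le_smul_avgHess hf hconv hlip ha hxy
  have hKH : K ≤ (1 + a) ^ 2 • hess f y := by
    have hyx := avgHess_le_smul_hess hf hconv hlip ha (by rwa [norm_sub_rev] at hxy)
    rw [avgHess_comm] at hyx
    rw [sq, mul_smul]
    exact smul_le_smul_of_nonneg_left hyx hpos.le
  have hQ : 0 ≤ bfgs D K v := hK.posSemidef.nonneg.trans (le_bfgs hK hKD v)
  calc sigma (bfgs D K v) (hess f y) + d
      ≤ (1 + a) ^ 2 * (sigma (bfgs D K v) K + d) :=
        sigma_add_dim_le_of_le_smul (by positivity) hK (hH y) hKH hQ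
    _ ≤ (1 + a) ^ 2 * (sigma D K + d) := by gcongr; exact sigma_bfgs_le hK hKD v
    _ ≤ (1 + a) ^ 2 * (1 * (sigma D (hess f x) + d)) := by
        gcongr
        exact sigma_add_dim_le_of_le_smul one_pos (hH x) hK hHK (hK.posSemidef.nonneg.trans hKD)
    _ = (1 + a) ^ 2 * (sigma D (hess f x) + d) := by rw [one_mul]

end Secant

lemma norm_toEuclideanCLM_sub_hessOp_le (hL : 0 < L) (hf : ContDiff ℝ 2 f)
    (hsmooth : Smooth L f) {z : EuclideanSpace ℝ (Fin d)} (hH : (hess f z).PosDef)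
    {D : Matrix (Fin d) (Fin d) ℝ} (hD : hess f z ≤ D) :
    ‖toEuclideanCLM (𝕜 := ℝ) D - hessOp f z‖ ≤ L * sigma D (hess f z) := by
  have hsub : toEuclideanCLM (𝕜 := ℝ) D - hessOp f z = toEuclideanCLM (𝕜 := ℝ) (D - hess f z) := by
    rw [map_sub, hess, StarAlgEquiv.apply_symm_apply]
  have hnonneg : 0 ≤ D - hess f z := sub_nonneg.2 hD
  rw [hsub]
  exact (norm_toEuclideanCLM_le (nonneg_iff_posSemidef.1 hnonneg).trace_nonneg hnonneg
    (le_trace_smul_one hnonneg)).trans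
    (trace_sub_le_mul_sigma hL hH (hess_le_smul_one hf hsmooth z) hD)

lemma norm_toEuclideanCLM_sub_gradient_le (hL : 0 < L) (hLt : 0 ≤ Lt) (hf : ContDiff ℝ 2 f)
    (hsmooth : Smooth L f) (hlip : LipschitzHessian Lt f) {z : EuclideanSpace ℝ (Fin d)}
    (hH : (hess f z).PosDef) {D : Matrix (Fin d) (Fin d) ℝ} (hD : hess f z ≤ D)
    (y : EuclideanSpace ℝ (Fin d)) :
    ‖toEuclideanCLM (𝕜 := ℝ) D (z - y) - (gradient f z - gradient f y)‖ ≤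
      (L * sigma D (hess f z) + Lt * ‖z - y‖) * ‖z - y‖ := by
  have htaylor := norm_sub_sub_fderiv_le ((contDiff_gradient hf).differentiable one_ne_zero) hLt
    (hlip z) y
  rw [norm_sub_rev y z] at htaylor
  have hsplit : toEuclideanCLM (𝕜 := ℝ) D (z - y) - (gradient f z - gradient f y) =
      (toEuclideanCLM (𝕜 := ℝ) D - hessOp f z) (z - y) +
        (gradient f y - gradient f z - fderiv ℝ (gradient f) z (y - z)) := by
    rw [_root_.sub_apply, hessOp, ← neg_sub z y, map_neg]
    abel
  calc _ ≤ ‖(toEuclideanCLM (𝕜 := ℝ) D - hessOp f z) (z - y)‖ + Lt * ‖z - y‖ ^ 2 := by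
        rw [hsplit]
        exact norm_add_le_of_le le_rfl htaylor
    _ ≤ L * sigma D (hess f z) * ‖z - y‖ + Lt * ‖z - y‖ ^ 2 := by
        gcongr
        exact ContinuousLinearMap.le_of_opNorm_le _
          (norm_toEuclideanCLM_sub_hessOp_le hL hf hsmooth hH hD) _
    _ = (L * sigma D (hess f z) + Lt * ‖z - y‖) * ‖z - y‖ := by ring

/-- The functions to which the method applies: twice continuously differentiable, `μ`-strongly
convex and `L`-smooth, with `Lt`-Lipschitz Hessian. -/
structure IsRegular (μ L Lt : ℝ) (f : EuclideanSpace ℝ (Fin d) → ℝ) : Prop where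
  contDiff : ContDiff ℝ 2 f
  stronglyConvex : StronglyConvex μ f
  smooth : Smooth L f
  lipschitzHessian : LipschitzHessian Lt f

lemma IsRegular.posDef_hess (hμ : 0 < μ) (hf : IsRegular μ L Lt f)
    (x : EuclideanSpace ℝ (Fin d)) : (hess f x).PosDef :=
  SLIQN.posDef_hess hμ hf.contDiff hf.stronglyConvex x

lemma norm_sub_le_of_eq_inv_mulVec {κ : Type*} [Fintype κ] [Nonempty κ]
    {f : κ → EuclideanSpace ℝ (Fin d) → ℝ} (hμ : 0 < μ) (hL : 0 < L) (hLt : 0 ≤ Lt)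
    (hf : ∀ i, IsRegular μ L Lt (f i)) {xs : EuclideanSpace ℝ (Fin d)}
    (hxs : ∑ i, gradient (f i) xs = 0) {z : κ → EuclideanSpace ℝ (Fin d)}
    {D : κ → Matrix (Fin d) (Fin d) ℝ} (hD : ∀ i, hess (f i) (z i) ≤ D i) {b R : ℝ}
    (hσ : ∀ i, sigma (D i) (hess (f i) (z i)) ≤ b) (hz : ∀ i, ‖z i - xs‖ ≤ R)
    {x : EuclideanSpace ℝ (Fin d)}
    (hx : x.ofLp = (∑ i, D i)⁻¹ *ᵥ ∑ i, (D i *ᵥ (z i).ofLp - (gradient (f i) (z i)).ofLp)) :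
    ‖x - xs‖ ≤ (L * b + Lt * R) / μ * ((1 / (Fintype.card κ : ℝ)) * ∑ i, ‖z i - xs‖) := by
  have hsum : (Fintype.card κ * μ) • (1 : Matrix (Fin d) (Fin d) ℝ) ≤ ∑ i, D i := by
    rw [mul_smul, Nat.cast_smul_eq_nsmul]
    exact Finset.card_nsmul_le_sum _ _ _ fun i _ =>
      (smul_one_le_hess (hf i).contDiff (hf i).stronglyConvex (z i)).trans (hD i)
  have hresidual : toEuclideanCLM (𝕜 := ℝ) (∑ i, D i) (x - xs) =
      ∑ i, (toEuclideanCLM (𝕜 := ℝ) (D i) (z i - xs) -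
        (gradient (f i) (z i) - gradient (f i) xs)) := by
    apply WithLp.ofLp_injective
    simpa only [ofLp_toEuclideanCLM, WithLp.ofLp_sum, WithLp.ofLp_sub] using
      sum_mulVec_sub_of_eq_inv_mulVec (posDef_of_le (PosDef.one.smul (by positivity)) hsum)
        (by simpa using congrArg WithLp.ofLp hxs) hx xs.ofLp
  have hterm (i : κ) : ‖toEuclideanCLM (𝕜 := ℝ) (D i) (z i - xs) -
      (gradient (f i) (z i) - gradient (f i) xs)‖ ≤ (L * b + Lt * R) * ‖z i - xs‖ := by
    refine (norm_toEuclideanCLM_sub_gradient_le hL hLt (hf i).contDiff (hf i).smooth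
      (hf i).lipschitzHessian ((hf i).posDef_hess hμ _) (hD i) xs).trans ?_
    gcongr
    exacts [hσ i, hz i]
  have hbound := calc Fintype.card κ * μ * ‖x - xs‖
      ≤ ‖toEuclideanCLM (𝕜 := ℝ) (∑ i, D i) (x - xs)‖ := mul_norm_le_norm_toEuclideanCLM hsum _
    _ ≤ ∑ i, (L * b + Lt * R) * ‖z i - xs‖ := by
        rw [hresidual]
        exact norm_sum_le_of_le _ fun i _ => hterm i
    _ = (L * b + Lt * R) * ∑ i, ‖z i - xs‖ := by rw [Finset.mul_sum]
  calc ‖x - xs‖ ≤ (L * b + Lt * R) * (∑ i, ‖z i - xs‖) / (Fintype.card κ * μ) := by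
        rwa [le_div_iff₀' (by positivity)]
    _ = (L * b + Lt * R) / μ * ((1 / (Fintype.card κ : ℝ)) * ∑ i, ‖z i - xs‖) := by field_simp

end Update

section CyclicOrder

variable {n : ℕ} [NeZero n]

lemma idx_add_self {t : ℕ} (ht : 1 ≤ t) : idx n (t + n) = idx n t := by
  rw [idx, idx, Fin.mk.injEq, Nat.sub_add_comm ht, Nat.add_mod_right]

lemma injOn_idx (t : ℕ) : Set.InjOn (idx n) (Set.Icc (t + 1) (t + n)) := by
  intro i hi j hj hij
  have hmod : i - 1 ≡ j - 1 [MOD n] := congrArg Fin.val hij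
  simp only [Set.mem_Icc] at hi hj
  have hclose : (i - 1 : ℕ) = (j - 1 : ℕ) := hmod.eq_of_abs_lt (by rw [abs_lt]; lia)
  lia

variable {X : Type*} {x : ℕ → X} {z : ℕ → Fin n → X}

lemma apply_idx_of_cyclic (hinit : ∀ i, z 0 i = x 0) (hactive : ∀ t, 1 ≤ t → z t (idx n t) = x t)
    (hrest : ∀ t, 1 ≤ t → ∀ i, i ≠ idx n t → z t i = z (t - 1) i) (t : ℕ) {k : ℕ} (hk : k < n) :
    z t (idx n (t + n - k)) = x (t - k) := by
  induction t generalizing k with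
  | zero => rw [hinit, Nat.zero_sub]
  | succ t ih =>
    cases k with
    | zero => rw [Nat.sub_zero, idx_add_self (by lia), hactive _ (by lia), Nat.sub_zero]
    | succ k =>
      have hne : idx n (t + n - k) ≠ idx n (t + 1) := fun h => by
        have := injOn_idx t ⟨by lia, by lia⟩ ⟨le_rfl, by lia⟩ h
        lia
      rw [show t + 1 + n - (k + 1) = t + n - k by lia, hrest _ (by lia) _ hne,
        Nat.add_sub_cancel, ih (by lia), Nat.add_sub_add_right]

lemma sum_eq_sum_Icc_of_cyclic {M : Type*} [AddCommMonoid M] (hinit : ∀ i, z 0 i = x 0)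
    (hactive : ∀ t, 1 ≤ t → z t (idx n t) = x t)
    (hrest : ∀ t, 1 ≤ t → ∀ i, i ≠ idx n t → z t i = z (t - 1) i) (g : X → M) (t : ℕ) :
    ∑ i, g (z t i) = ∑ k ∈ Finset.Icc 1 n, g (x (t + 1 - k)) := by
  have hinj : Set.InjOn (fun k => idx n (t + 1 + n - k)) (Finset.Icc 1 n) := by
    intro k hk l hl hkl
    simp only [Finset.coe_Icc, Set.mem_Icc] at hk hl
    have := injOn_idx t ⟨by lia, by lia⟩ ⟨by lia, by lia⟩ hkl
    lia
  refine (Finset.sum_nbij (fun k => idx n (t + 1 + n - k)) (fun _ _ => Finset.mem_univ _) hinj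
    (Finset.surjOn_of_injOn_of_card_le _ (fun _ _ => Finset.mem_univ _) hinj (by simp))
    fun k hk => ?_).symm
  obtain ⟨k, rfl⟩ := Nat.exists_eq_add_of_le' (Finset.mem_Icc.1 hk).1
  have hkn := (Finset.mem_Icc.1 hk).2
  rw [show t + 1 + n - (k + 1) = t + n - k by lia, Nat.add_sub_add_right,
    apply_idx_of_cyclic hinit hactive hrest t (by lia)]

lemma ceil_succ_div (t : ℕ) : ⌈((t + 1 : ℕ) : ℝ) / n⌉₊ = t / n + 1 := by
  have hn : (0 : ℝ) < n := by exact_mod_cast NeZero.pos n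
  have hlower : t / n * n ≤ t := Nat.div_mul_le_self t n
  have hupper : t < n * (t / n + 1) := Nat.lt_mul_div_succ t (NeZero.pos n)
  rw [Nat.ceil_eq_iff (by lia), Nat.add_sub_cancel, lt_div_iff₀ hn, div_le_iff₀ hn]
  norm_cast
  lia

lemma ceil_succ_div_sub_one (t : ℕ) : ⌈((t + 1 : ℕ) : ℝ) / n - 1⌉₊ = t / n := by
  rw [Nat.ceil_sub_one, ceil_succ_div, Nat.add_sub_cancel]

end CyclicOrder

section Block

variable {d : ℕ} {f : EuclideanSpace ℝ (Fin d) → ℝ} {μ L Lt w m R : ℝ}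
  {xs z : EuclideanSpace ℝ (Fin d)} {D : Matrix (Fin d) (Fin d) ℝ}

/-- The state of one component: the stored point `z` lies within `R` of `xs`, and `D` is the
multiple by `w` of a matrix that dominates `∇²f(z)` with error `σ` at most `m`. -/
structure Block (f : EuclideanSpace ℝ (Fin d) → ℝ) (xs : EuclideanSpace ℝ (Fin d)) (w m R : ℝ)
    (z : EuclideanSpace ℝ (Fin d)) (D : Matrix (Fin d) (Fin d) ℝ) : Prop where
  norm_sub_le : ‖z - xs‖ ≤ R
  smul_hess_le : w • hess f z ≤ D
  sigma_add_dim_le : sigma D (hess f z) + d ≤ w * (m + d)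

namespace Block

lemma hess_le (hblock : Block f xs w m R z D) (hH : (hess f z).PosDef) (hw : 1 ≤ w) :
    hess f z ≤ D := by
  refine le_trans ?_ hblock.smul_hess_le
  simpa using smul_le_smul_of_nonneg_right hw hH.posSemidef.nonneg

lemma smul (hblock : Block f xs 1 m R z D) (hH : (hess f z).PosDef) (hw : 0 ≤ w) :
    Block f xs w m R z (w • D) where
  norm_sub_le := hblock.norm_sub_le
  smul_hess_le := by
    simpa using smul_le_smul_of_nonneg_left hblock.smul_hess_le hw
  sigma_add_dim_le := by
    rw [sigma_smul_add_dim hH]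
    gcongr
    simpa using hblock.sigma_add_dim_le

variable {y : EuclideanSpace ℝ (Fin d)} {a : ℝ}

lemma lipschitz_mul_norm_sub_le (hblock : Block f xs w m R z D) (hLt : 0 ≤ Lt)
    (hy : ‖y - xs‖ ≤ R) (hR : Lt * R ≤ a * μ) : Lt * ‖y - z‖ ≤ 2 * (a * μ) := by
  have htri : ‖y - z‖ ≤ R + R := by
    rw [← sub_sub_sub_cancel_right y z xs]
    exact norm_sub_le_of_le hy hblock.norm_sub_le
  calc Lt * ‖y - z‖ ≤ Lt * (R + R) := by gcongr
    _ ≤ 2 * (a * μ) := by linarith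

lemma hess_le_bfgs_avgHess (hblock : Block f xs ((1 + a) ^ 2) m R z D) (hμ : 0 < μ)
    (hLt : 0 ≤ Lt) (hf : IsRegular μ L Lt f) (ha : 0 ≤ a) (hR : Lt * R ≤ a * μ)
    (hy : ‖y - xs‖ ≤ R) (v : Fin d → ℝ) :
    hess f y ≤ bfgs D ((1 + a) • avgHess f z y) v :=
  SLIQN.hess_le_bfgs_avgHess hμ hf.contDiff hf.stronglyConvex hf.lipschitzHessian ha
    (hblock.lipschitz_mul_norm_sub_le hLt hy hR) hblock.smul_hess_le v

lemma update (hblock : Block f xs ((1 + a) ^ 2) m R z D) (hμ : 0 < μ) (hL : 0 < L)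
    (hLt : 0 ≤ Lt) (hf : IsRegular μ L Lt f) (ha : 0 ≤ a) (hR : Lt * R ≤ a * μ)
    (hq : 0 ≤ 1 - μ / (d * L)) {m' R' : ℝ} (hR' : R' ≤ R) (hy : ‖y - xs‖ ≤ R')
    (hm' : (1 - μ / (d * L)) * ((1 + a) ^ 4 * (m + d) - d) ≤ m') {v u : Fin d → ℝ}
    (hu : IsGreedy (bfgs D ((1 + a) • avgHess f z y) v) (hess f y) u) :
    Block f xs 1 m' R' y (bfgs (bfgs D ((1 + a) • avgHess f z y) v) (hess f y) u) := by
  set Q := bfgs D ((1 + a) • avgHess f z y) v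
  have hyz := hblock.lipschitz_mul_norm_sub_le hLt (hy.trans hR') hR
  have hQ : hess f y ≤ Q := hblock.hess_le_bfgs_avgHess hμ hLt hf ha hR (hy.trans hR') v
  have hσQ : sigma Q (hess f y) + d ≤ (1 + a) ^ 4 * (m + d) := calc
    sigma Q (hess f y) + d ≤ (1 + a) ^ 2 * (sigma D (hess f z) + d) :=
      sigma_bfgs_avgHess_add_dim_le hμ hf.contDiff hf.stronglyConvex hf.lipschitzHessian ha hyz
        hblock.smul_hess_le v
    _ ≤ (1 + a) ^ 2 * ((1 + a) ^ 2 * (m + d)) := by gcongr; exact hblock.sigma_add_dim_le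
    _ = (1 + a) ^ 4 * (m + d) := by ring
  refine ⟨hy, ?_, ?_⟩
  · rw [one_smul]
    exact le_bfgs (hf.posDef_hess hμ y) hQ u
  · have hgreedy := hu.sigma_bfgs_le hμ hL (smul_one_le_hess hf.contDiff hf.stronglyConvex y)
      (hess_le_smul_one hf.contDiff hf.smooth y) hQ
    have hcontract := mul_le_mul_of_nonneg_left (le_sub_iff_add_le.2 hσQ) hq
    linarith

end Block

end Block

section Invariant

/-- Sequences, indexed by the epoch `p`, that close the induction along a run: correction factors
`α`, radii `R` bounding the distances to the minimizer, bounds `m` on the error `σ` right after an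
update, bounds `b` on the error of every component during the epoch, and a contraction factor
`q`. -/
structure ErrorBudget (d : ℕ) (μ L Lt q : ℝ) (α R m b : ℕ → ℝ) : Prop where
  alpha_nonneg : ∀ p, 0 ≤ α p
  radius_nonneg : ∀ p, 0 ≤ R p
  error_nonneg : ∀ p, 0 ≤ b p
  lipschitz_mul_radius_le : ∀ p, Lt * R p ≤ α p * μ
  radius_succ_le : ∀ p, R (p + 1) ≤ R p
  contract_le : ∀ p, q * ((1 + α p) ^ 4 * (m p + d) - d) ≤ m (p + 1)
  updated_le : ∀ p, m (p + 1) ≤ b p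
  scaled_le : ∀ p, (1 + α p) ^ 2 * (m p + d) - d ≤ b p
  rate_mul_radius_le : ∀ p, (L * b p + Lt * R p) / μ * R p ≤ R (p + 1)
  rate_le : ∀ p, (L * b p + Lt * R p) / μ ≤ q ^ (p + 1)

variable {d n : ℕ} {f : Fin n → EuclideanSpace ℝ (Fin d) → ℝ} {μ L Lt : ℝ}
  {xs : EuclideanSpace ℝ (Fin d)} {α R m b : ℕ → ℝ} {t : ℕ}

/-- The state of all components after `t` iterations: those updated in the current epoch
`p = t / n` are unscaled, the others carry the correction factor `(1 + α p) ^ 2` applied at the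
end of the previous epoch. -/
def BlockInvariant (f : Fin n → EuclideanSpace ℝ (Fin d) → ℝ) (xs : EuclideanSpace ℝ (Fin d))
    (α R m : ℕ → ℝ) (t : ℕ) (z : Fin n → EuclideanSpace ℝ (Fin d))
    (D : Fin n → Matrix (Fin d) (Fin d) ℝ) : Prop :=
  ∀ i : Fin n,
    (i.val < t % n → Block (f i) xs 1 (m (t / n + 1)) (R (t / n + 1)) (z i) (D i)) ∧
    (t % n ≤ i.val → Block (f i) xs ((1 + α (t / n)) ^ 2) (m (t / n)) (R (t / n)) (z i) (D i))

namespace BlockInvariant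

variable {q : ℝ} {z : Fin n → EuclideanSpace ℝ (Fin d)} {D : Fin n → Matrix (Fin d) (Fin d) ℝ}

lemma norm_sub_le (hinv : BlockInvariant f xs α R m t z D)
    (hbudget : ErrorBudget d μ L Lt q α R m b) (i : Fin n) : ‖z i - xs‖ ≤ R (t / n) := by
  rcases lt_or_ge i.val (t % n) with hupdated | hold
  · exact ((hinv i).1 hupdated).norm_sub_le.trans (hbudget.radius_succ_le _)
  · exact ((hinv i).2 hold).norm_sub_le

lemma hess_le (hinv : BlockInvariant f xs α R m t z D)
    (hbudget : ErrorBudget d μ L Lt q α R m b) (hH : ∀ i, (hess (f i) (z i)).PosDef)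
    (i : Fin n) : hess (f i) (z i) ≤ D i := by
  rcases lt_or_ge i.val (t % n) with hupdated | hold
  · exact ((hinv i).1 hupdated).hess_le (hH i) le_rfl
  · exact ((hinv i).2 hold).hess_le (hH i)
      (one_le_pow₀ (le_add_of_nonneg_right (hbudget.alpha_nonneg _)))

lemma sigma_le (hinv : BlockInvariant f xs α R m t z D)
    (hbudget : ErrorBudget d μ L Lt q α R m b) (i : Fin n) :
    sigma (D i) (hess (f i) (z i)) ≤ b (t / n) := by
  rcases lt_or_ge i.val (t % n) with hupdated | hold
  · linarith [((hinv i).1 hupdated).sigma_add_dim_le, hbudget.updated_le (t / n)]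
  · linarith [((hinv i).2 hold).sigma_add_dim_le, hbudget.scaled_le (t / n)]

lemma posDef (hinv : BlockInvariant f xs α R m t z D)
    (hbudget : ErrorBudget d μ L Lt q α R m b) (hH : ∀ i, (hess (f i) (z i)).PosDef)
    (i : Fin n) : (D i).PosDef :=
  posDef_of_le (hH i) (hinv.hess_le hbudget hH i)

end BlockInvariant

end Invariant

section Run

variable {d n : ℕ} [NeZero n] {f : Fin n → EuclideanSpace ℝ (Fin d) → ℝ} {μ L Lt : ℝ}
  {xs : EuclideanSpace ℝ (Fin d)} {α R m b : ℕ → ℝ} {x0 : EuclideanSpace ℝ (Fin d)}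
  {I0 : Fin n → Matrix (Fin d) (Fin d) ℝ} {x : ℕ → EuclideanSpace ℝ (Fin d)}
  {z : ℕ → Fin n → EuclideanSpace ℝ (Fin d)} {D : ℕ → Fin n → Matrix (Fin d) (Fin d) ℝ}
  {Q : ℕ → Matrix (Fin d) (Fin d) ℝ} {u : ℕ → Fin d → ℝ} {t : ℕ}

namespace IsRun

lemma dim_pos (hrun : IsRun f α x0 I0 x z D Q u) : 0 < d := by
  obtain ⟨⟨k, -⟩, -⟩ := hrun.u_greedy 1 le_rfl
  exact k.pos

lemma Q_succ (hrun : IsRun f α x0 I0 x z D Q u) (t : ℕ) :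
    Q (t + 1) = bfgs (D t (idx n (t + 1)))
      ((1 + α (t / n)) •
        avgHess (f (idx n (t + 1))) (z t (idx n (t + 1))) (z (t + 1) (idx n (t + 1))))
      (z (t + 1) (idx n (t + 1)) - z t (idx n (t + 1))).ofLp := by
  rw [hrun.Q_step (t + 1) (by lia), ceil_succ_div_sub_one, Nat.add_sub_cancel]

lemma sum_norm_sub_eq (hrun : IsRun f α x0 I0 x z D Q u) (y : EuclideanSpace ℝ (Fin d)) (t : ℕ) :
    ∑ i, ‖z t i - y‖ = ∑ k ∈ Finset.Icc 1 n, ‖x (t + 1 - k) - y‖ :=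
  sum_eq_sum_Icc_of_cyclic (fun i => (hrun.z_init i).trans hrun.x_init.symm) hrun.z_active
    hrun.z_rest (fun w => ‖w - y‖) t

lemma exists_block_of_le (hrun : IsRun f α x0 I0 x z D Q u)
    (hinv : BlockInvariant f xs α R m t (z t) (D t))
    (hactive : Block (f (idx n (t + 1))) xs 1 (m (t / n + 1)) (R (t / n + 1))
      (z (t + 1) (idx n (t + 1)))
      (bfgs (Q (t + 1)) (hess (f (idx n (t + 1))) (z (t + 1) (idx n (t + 1)))) (u (t + 1))))
    {i : Fin n} (hi : i.val ≤ t % n) :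
    ∃ D', D (t + 1) i = omega α n (t + 1) • D' ∧
      Block (f i) xs 1 (m (t / n + 1)) (R (t / n + 1)) (z (t + 1) i) D' := by
  rcases eq_or_ne i (idx n (t + 1)) with rfl | hne
  · exact ⟨_, hrun.D_active (t + 1) (by lia), hactive⟩
  · refine ⟨_, hrun.D_rest (t + 1) (by lia) i hne, ?_⟩
    rw [hrun.z_rest (t + 1) (by lia) i hne]
    exact (hinv i).1 (lt_of_le_of_ne hi fun h => hne (Fin.ext h))

lemma blockInvariant_zero (hrun : IsRun f α x0 I0 x z D Q u) (hH : ∀ i, (hess (f i) x0).PosDef)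
    (hx0 : ‖x0 - xs‖ ≤ R 0) (hI0 : ∀ i, hess (f i) x0 ≤ I0 i)
    (hσ : ∀ i, sigma (I0 i) (hess (f i) x0) ≤ m 0) :
    BlockInvariant f xs α R m 0 (z 0) (D 0) := by
  intro i
  rw [Nat.zero_div, Nat.zero_mod, hrun.z_init, hrun.D_init]
  exact ⟨fun h => absurd h (by lia), fun _ => Block.smul
    ⟨hx0, by simpa using hI0 i, by simpa using hσ i⟩ (hH i) (sq_nonneg _)⟩

variable {q : ℝ} (hrun : IsRun f α x0 I0 x z D Q u) (hμ : 0 < μ) (hL : 0 < L) (hLt : 0 ≤ Lt)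
  (hf : ∀ i, IsRegular μ L Lt (f i)) (hxs : ∑ i, gradient (f i) xs = 0)

include hrun hμ hL hLt hf hxs

lemma norm_iterate_sub_le (hbudget : ErrorBudget d μ L Lt q α R m b)
    (hinv : BlockInvariant f xs α R m t (z t) (D t)) :
    ‖x (t + 1) - xs‖ ≤
      (L * b (t / n) + Lt * R (t / n)) / μ * ((1 / (n : ℝ)) * ∑ i, ‖z t i - xs‖) := by
  simpa using norm_sub_le_of_eq_inv_mulVec hμ hL hLt hf hxs
    (hinv.hess_le hbudget fun i => (hf i).posDef_hess hμ _) (hinv.sigma_le hbudget)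
    (hinv.norm_sub_le hbudget) (by simpa using hrun.x_step (t + 1) (by lia))

lemma norm_iterate_sub_le_pow_mul (hbudget : ErrorBudget d μ L Lt q α R m b)
    (hinv : BlockInvariant f xs α R m t (z t) (D t)) :
    ‖x (t + 1) - xs‖ ≤
      q ^ ⌈((t + 1 : ℕ) : ℝ) / n⌉₊ *
        ((1 / (n : ℝ)) * ∑ k ∈ Finset.Icc 1 n, ‖x (t + 1 - k) - xs‖) := by
  rw [ceil_succ_div, ← hrun.sum_norm_sub_eq]
  refine (hrun.norm_iterate_sub_le hμ hL hLt hf hxs hbudget hinv).trans ?_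
  gcongr
  exact hbudget.rate_le _

lemma norm_iterate_sub_le_radius (hbudget : ErrorBudget d μ L Lt q α R m b)
    (hinv : BlockInvariant f xs α R m t (z t) (D t)) :
    ‖x (t + 1) - xs‖ ≤ R (t / n + 1) := by
  have hn : (0 : ℝ) < n := by exact_mod_cast NeZero.pos n
  have hrate : 0 ≤ (L * b (t / n) + Lt * R (t / n)) / μ := by
    have := hbudget.error_nonneg (t / n)
    have := hbudget.radius_nonneg (t / n)
    positivity
  have hmean : (1 / (n : ℝ)) * ∑ i, ‖z t i - xs‖ ≤ R (t / n) := by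
    rw [one_div, inv_mul_le_iff₀ hn]
    simpa using Finset.sum_le_card_nsmul Finset.univ _ _ fun i _ => hinv.norm_sub_le hbudget i
  calc ‖x (t + 1) - xs‖ ≤ _ := hrun.norm_iterate_sub_le hμ hL hLt hf hxs hbudget hinv
    _ ≤ (L * b (t / n) + Lt * R (t / n)) / μ * R (t / n) := by gcongr
    _ ≤ R (t / n + 1) := hbudget.rate_mul_radius_le _

lemma posDef_Q_succ (hbudget : ErrorBudget d μ L Lt q α R m b)
    (hinv : BlockInvariant f xs α R m t (z t) (D t)) : (Q (t + 1)).PosDef := by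
  have hclose := hrun.norm_iterate_sub_le_radius hμ hL hLt hf hxs hbudget hinv
  rw [← hrun.z_active (t + 1) (by lia)] at hclose
  rw [hrun.Q_succ]
  exact posDef_of_le ((hf _).posDef_hess hμ _) (((hinv _).2 le_rfl).hess_le_bfgs_avgHess hμ hLt
    (hf _) (hbudget.alpha_nonneg _) (hbudget.lipschitz_mul_radius_le _)
    (hclose.trans (hbudget.radius_succ_le _)) _)

variable (hq : 0 ≤ 1 - μ / (d * L)) (hbudget : ErrorBudget d μ L Lt (1 - μ / (d * L)) α R m b)

include hq hbudget

lemma block_active (hinv : BlockInvariant f xs α R m t (z t) (D t)) :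
    Block (f (idx n (t + 1))) xs 1 (m (t / n + 1)) (R (t / n + 1)) (z (t + 1) (idx n (t + 1)))
      (bfgs (Q (t + 1)) (hess (f (idx n (t + 1))) (z (t + 1) (idx n (t + 1)))) (u (t + 1))) := by
  have hgreedy := hrun.u_greedy (t + 1) (by lia)
  have hclose := hrun.norm_iterate_sub_le_radius hμ hL hLt hf hxs hbudget hinv
  rw [← hrun.z_active (t + 1) (by lia)] at hclose
  rw [hrun.Q_succ] at hgreedy ⊢
  exact ((hinv (idx n (t + 1))).2 le_rfl).update hμ hL hLt (hf _) (hbudget.alpha_nonneg _)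
    (hbudget.lipschitz_mul_radius_le _) hq (hbudget.radius_succ_le _) hclose
    (hbudget.contract_le _) hgreedy

lemma blockInvariant_succ (hinv : BlockInvariant f xs α R m t (z t) (D t)) :
    BlockInvariant f xs α R m (t + 1) (z (t + 1)) (D (t + 1)) := by
  have hupdated {i : Fin n} := hrun.exists_block_of_le hinv
    (hrun.block_active hμ hL hLt hf hxs hq hbudget hinv) (i := i)
  have hdivmod := Nat.div_add_mod t n
  have hdivmod' := Nat.div_add_mod (t + 1) n
  intro i
  by_cases hend : (t + 1) % n = 0
  · have hdiv : (t + 1) / n = t / n + 1 := Nat.succ_div_of_mod_eq_zero hend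
    have homega : omega α n (t + 1) = (1 + α (t / n + 1)) ^ 2 := by
      rw [omega, if_pos hend, ceil_succ_div]
    rw [hend, hdiv, mul_add] at hdivmod'
    obtain ⟨D', hD', hblock⟩ := hupdated (i := i) (by lia)
    rw [hend, hdiv, hD', homega]
    exact ⟨fun h => absurd h (by lia), fun _ =>
      hblock.smul ((hf i).posDef_hess hμ _) (sq_nonneg _)⟩
  · have hdiv : (t + 1) / n = t / n := Nat.succ_div_of_mod_ne_zero hend
    have homega : omega α n (t + 1) = 1 := if_neg hend
    have hmod : (t + 1) % n = t % n + 1 := by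
      rw [hdiv] at hdivmod'
      lia
    rw [hdiv, hmod]
    refine ⟨fun hi => ?_, fun hi => ?_⟩
    · obtain ⟨D', hD', hblock⟩ := hupdated (i := i) (by lia)
      rwa [hD', homega, one_smul]
    · have hne : i ≠ idx n (t + 1) := fun h => absurd (congrArg Fin.val h) (by
        change i.val ≠ t % n
        lia)
      rw [hrun.z_rest (t + 1) (by lia) i hne, hrun.D_rest (t + 1) (by lia) i hne, homega, one_smul]
      exact (hinv i).2 (by lia)

lemma blockInvariant (hx0 : ‖x0 - xs‖ ≤ R 0) (hI0 : ∀ i, hess (f i) x0 ≤ I0 i)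
    (hσ : ∀ i, sigma (I0 i) (hess (f i) x0) ≤ m 0) (t : ℕ) :
    BlockInvariant f xs α R m t (z t) (D t) := by
  induction t with
  | zero => exact hrun.blockInvariant_zero (fun i => (hf i).posDef_hess hμ x0) hx0 hI0 hσ
  | succ t ih => exact hrun.blockInvariant_succ hμ hL hLt hf hxs hq hbudget ih

end IsRun

end Run

section Budget

open Filter Topology

variable {d : ℕ} {μ L Lt q ρ κ ε c : ℝ}

lemma one_add_pow_four_le {y : ℝ} (hy : 0 ≤ y) (hy1 : y ≤ 1) : (1 + y) ^ 4 ≤ 1 + 15 * y := by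
  have hy2 : y ^ 2 ≤ y := pow_le_of_le_one hy hy1 two_ne_zero
  have hy3 : y ^ 3 ≤ y := pow_le_of_le_one hy hy1 three_ne_zero
  have hy4 : y ^ 4 ≤ y := pow_le_of_le_one hy hy1 four_ne_zero
  linarith [show (1 + y) ^ 4 = 1 + 4 * y + 6 * y ^ 2 + 4 * y ^ 3 + y ^ 4 by ring]

section Correction

variable (hκε : 0 ≤ κ * ε) (hκε1 : κ * ε ≤ 1) (hc : 0 ≤ c) (hρ : 0 ≤ ρ) (hρq : ρ ≤ q)
  (hq1 : q ≤ 1) (hsmall : 15 * (κ * ε) * (2 * c + d) ≤ c * (q - ρ)) (p : ℕ)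

include hκε hκε1 hc hρ hρq hq1 hsmall

lemma one_add_pow_four_mul_add_sub_le :
    (1 + κ * ε * ρ ^ p) ^ 4 * (c * (2 * q ^ p - ρ ^ p) + d) - d ≤
      c * (2 * q ^ p - ρ ^ p) + c * (q - ρ) * ρ ^ p := by
  have hpow : ρ ^ p ≤ q ^ p := by gcongr
  have hρp : 0 ≤ ρ ^ p := by positivity
  have hqp : q ^ p ≤ 1 := pow_le_one₀ (hρ.trans hρq) hq1
  have hexpand : (1 + κ * ε * ρ ^ p) ^ 4 ≤ 1 + 15 * (κ * ε * ρ ^ p) :=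
    one_add_pow_four_le (by positivity) (mul_le_one₀ hκε1 hρp (hpow.trans hqp))
  have hm : 0 ≤ c * (2 * q ^ p - ρ ^ p) := mul_nonneg hc (by linarith)
  have hm2 : c * (2 * q ^ p - ρ ^ p) ≤ 2 * c := by
    rw [mul_comm 2 c]
    gcongr
    linarith
  have hexcess := calc
    15 * (κ * ε * ρ ^ p) * (c * (2 * q ^ p - ρ ^ p) + d) ≤ 15 * (κ * ε * ρ ^ p) * (2 * c + d) := by
      gcongr
    _ = 15 * (κ * ε) * (2 * c + d) * ρ ^ p := by ring
    _ ≤ c * (q - ρ) * ρ ^ p := by gcongr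
  have hscale := mul_le_mul_of_nonneg_right hexpand (add_nonneg hm d.cast_nonneg)
  linarith

lemma mul_one_add_pow_four_mul_add_sub_le :
    q * ((1 + κ * ε * ρ ^ p) ^ 4 * (c * (2 * q ^ p - ρ ^ p) + d) - d) ≤
      c * (2 * q ^ (p + 1) - ρ ^ (p + 1)) := by
  have hgain : 0 ≤ c * (q - ρ) * ρ ^ p := by
    have := sub_nonneg.2 hρq
    positivity
  calc q * ((1 + κ * ε * ρ ^ p) ^ 4 * (c * (2 * q ^ p - ρ ^ p) + d) - d)
      ≤ q * (c * (2 * q ^ p - ρ ^ p) + c * (q - ρ) * ρ ^ p) :=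
        mul_le_mul_of_nonneg_left
          (one_add_pow_four_mul_add_sub_le hκε hκε1 hc hρ hρq hq1 hsmall p) (hρ.trans hρq)
    _ ≤ q * (c * (2 * q ^ p - ρ ^ p)) + c * (q - ρ) * ρ ^ p := by
        rw [mul_add]
        exact add_le_add le_rfl (mul_le_of_le_one_left hgain hq1)
    _ = c * (2 * q ^ (p + 1) - ρ ^ (p + 1)) := by ring

lemma one_add_sq_mul_add_sub_le :
    (1 + κ * ε * ρ ^ p) ^ 2 * (c * (2 * q ^ p - ρ ^ p) + d) - d ≤ 2 * c * q ^ p := by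
  have hpow : ρ ^ p ≤ q ^ p := by gcongr
  have hm : 0 ≤ c * (2 * q ^ p - ρ ^ p) :=
    mul_nonneg hc (by linarith [pow_nonneg (hρ.trans hρq) p])
  calc (1 + κ * ε * ρ ^ p) ^ 2 * (c * (2 * q ^ p - ρ ^ p) + d) - d
      ≤ (1 + κ * ε * ρ ^ p) ^ 4 * (c * (2 * q ^ p - ρ ^ p) + d) - d := by
        gcongr 1
        refine mul_le_mul_of_nonneg_right ?_ (by positivity)
        exact pow_le_pow_right₀ (le_add_of_nonneg_right (by positivity)) (by norm_num)
    _ ≤ c * (2 * q ^ p - ρ ^ p) + c * (q - ρ) * ρ ^ p :=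
        one_add_pow_four_mul_add_sub_le hκε hκε1 hc hρ hρq hq1 hsmall p
    _ ≤ c * (2 * q ^ p - ρ ^ p) + c * 1 * ρ ^ p := by gcongr; linarith
    _ = 2 * c * q ^ p := by ring

end Correction

lemma rate_le_mul_pow (hμ : 0 < μ) (hρ : 0 ≤ ρ) (hρq : ρ ≤ q) (hLc : 4 * (L * c) ≤ μ * ρ)
    (hLtε : 2 * (Lt * ε) ≤ μ * ρ) (p : ℕ) :
    (L * (2 * c * q ^ p) + Lt * (ε * ρ ^ p)) / μ ≤ ρ * q ^ p := by
  have hq : 0 ≤ q := hρ.trans hρq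
  have hhessian : L * (2 * c * q ^ p) ≤ μ * ρ / 2 * q ^ p := calc
    L * (2 * c * q ^ p) = 2 * (L * c) * q ^ p := by ring
    _ ≤ μ * ρ / 2 * q ^ p := by gcongr; linarith
  have hlipschitz : Lt * (ε * ρ ^ p) ≤ μ * ρ / 2 * q ^ p := calc
    Lt * (ε * ρ ^ p) = Lt * ε * ρ ^ p := by ring
    _ ≤ μ * ρ / 2 * ρ ^ p := by gcongr; linarith
    _ ≤ μ * ρ / 2 * q ^ p := by gcongr
  rw [div_le_iff₀ hμ]
  linarith

lemma errorBudget_geometric (hμ : 0 < μ) (hκμ : Lt ≤ κ * μ) (hκ : 0 ≤ κ) (hε : 0 ≤ ε)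
    (hκε : κ * ε ≤ 1) (hc : 0 ≤ c) (hρ : 0 ≤ ρ) (hρq : ρ ≤ q) (hq1 : q ≤ 1)
    (hLc : 4 * (L * c) ≤ μ * ρ) (hLtε : 2 * (Lt * ε) ≤ μ * ρ)
    (hsmall : 15 * (κ * ε) * (2 * c + d) ≤ c * (q - ρ)) :
    ErrorBudget d μ L Lt q (fun p => κ * ε * ρ ^ p) (fun p => ε * ρ ^ p)
      (fun p => c * (2 * q ^ p - ρ ^ p)) (fun p => 2 * c * q ^ p) := by
  have hq : 0 ≤ q := hρ.trans hρq
  have hrate := rate_le_mul_pow hμ hρ hρq hLc hLtε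
  exact {
    alpha_nonneg p := by positivity
    radius_nonneg p := by positivity
    error_nonneg p := by positivity
    lipschitz_mul_radius_le p := calc
      Lt * (ε * ρ ^ p) ≤ κ * μ * (ε * ρ ^ p) := by gcongr
      _ = κ * ε * ρ ^ p * μ := by ring
    radius_succ_le p :=
      mul_le_mul_of_nonneg_left (pow_le_pow_of_le_one hρ (hρq.trans hq1) p.le_succ) hε
    contract_le :=
      mul_one_add_pow_four_mul_add_sub_le (mul_nonneg hκ hε) hκε hc hρ hρq hq1 hsmall
    updated_le p := calc
      c * (2 * q ^ (p + 1) - ρ ^ (p + 1)) ≤ c * (2 * q ^ (p + 1)) := by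
        gcongr
        exact sub_le_self _ (by positivity)
      _ ≤ c * (2 * q ^ p) := by gcongr c * (2 * ?_); exact pow_le_pow_of_le_one hq hq1 p.le_succ
      _ = 2 * c * q ^ p := by ring
    scaled_le := one_add_sq_mul_add_sub_le (mul_nonneg hκ hε) hκε hc hρ hρq hq1 hsmall
    rate_mul_radius_le p := calc
      _ ≤ ρ * q ^ p * (ε * ρ ^ p) := by gcongr; exact hrate p
      _ ≤ ρ * 1 * (ε * ρ ^ p) := by gcongr; exact pow_le_one₀ hq hq1
      _ = ε * ρ ^ (p + 1) := by ring
    rate_le p := calc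
      _ ≤ ρ * q ^ p := hrate p
      _ ≤ q ^ (p + 1) := by rw [pow_succ']; gcongr }

lemma eventually_mul_le_nhdsGT_zero (A : ℝ) {B : ℝ} (hB : 0 < B) : ∀ᶠ x in 𝓝[>] 0, A * x ≤ B := by
  have hlim : Tendsto (fun x => A * x) (𝓝 0) (𝓝 (A * 0)) := tendsto_id.const_mul A
  rw [mul_zero] at hlim
  exact (hlim.mono_left nhdsWithin_le_nhds).eventually (eventually_le_nhds hB)

lemma exists_errorBudget (d : ℕ) (hμ : 0 < μ) (hL : 0 < L) (hκ : 0 ≤ κ) (hκμ : Lt ≤ κ * μ)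
    (hρ : 0 < ρ) (hρq : ρ < q) (hq1 : q ≤ 1) :
    ∃ (ε σ₀ : ℝ) (R m b : ℕ → ℝ), 0 < ε ∧ 0 < σ₀ ∧ R 0 = ε ∧ m 0 = σ₀ ∧
      ErrorBudget d μ L Lt q (fun p => κ * ε * ρ ^ p) R m b := by
  set c := μ * ρ / (4 * L) with hc
  have hc0 : 0 < c := by positivity
  have hLc : 4 * (L * c) = μ * ρ := by rw [hc]; field_simp
  obtain ⟨ε, hε, hκε, hLtε, hsmall⟩ := (eventually_mem_nhdsWithin.and
    ((eventually_mul_le_nhdsGT_zero κ one_pos).and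
      ((eventually_mul_le_nhdsGT_zero (2 * Lt) (mul_pos hμ hρ)).and
        (eventually_mul_le_nhdsGT_zero (15 * κ * (2 * c + d))
          (mul_pos hc0 (sub_pos.2 hρq)))))).exists
  exact ⟨ε, c, _, _, _, hε, hc0, by simp, by norm_num, errorBudget_geometric hμ hκμ hκ hε.le hκε
    hc0.le hρ.le hρq.le hq1 hLc.le (by linarith) (by linarith)⟩

lemma StronglyConvex.le_of_smooth (hd : 0 < d) {f : EuclideanSpace ℝ (Fin d) → ℝ}
    (hconv : StronglyConvex μ f) (hsmooth : Smooth L f) : μ ≤ L := by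
  have hlower := hconv 0 (EuclideanSpace.single ⟨0, hd⟩ 1)
  have hupper := hsmooth 0 (EuclideanSpace.single ⟨0, hd⟩ 1)
  simp only [sub_zero, PiLp.norm_single, norm_one, one_pow, mul_one] at hlower hupper
  linarith

lemma one_le_rpow_mul_sqrt_mul (hμ : 0 < μ) (hμL : μ ≤ L) :
    1 ≤ μ ^ (-(3 / 2) : ℝ) * √L * μ := by
  calc (1 : ℝ) = μ ^ (-(3 / 2) : ℝ) * μ ^ (1 / 2 : ℝ) * μ ^ (1 : ℝ) := by
        rw [← Real.rpow_add hμ, ← Real.rpow_add hμ]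
        norm_num
    _ = μ ^ (-(3 / 2) : ℝ) * √μ * μ := by rw [Real.rpow_one, Real.sqrt_eq_rpow]
    _ ≤ μ ^ (-(3 / 2) : ℝ) * √L * μ := by gcongr

lemma exists_errorBudget_alpha (d : ℕ) (hμ : 0 < μ) (hμL : μ ≤ L) (hLt : 0 ≤ Lt) (hρ : 0 < ρ)
    (hρq : ρ < q) (hq1 : q ≤ 1) :
    ∃ (ε σ₀ : ℝ) (R m b : ℕ → ℝ), 0 < ε ∧ 0 < σ₀ ∧ R 0 = ε ∧ m 0 = σ₀ ∧
      ErrorBudget d μ L Lt q (alpha μ L Lt ε ρ) R m b := by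
  have hκμ : Lt ≤ Lt * μ ^ (-(3 / 2) : ℝ) * √L * μ := by
    simpa only [mul_one, mul_assoc] using
      mul_le_mul_of_nonneg_left (one_le_rpow_mul_sqrt_mul hμ hμL) hLt
  exact exists_errorBudget d hμ (hμ.trans_le hμL) (by positivity) hκμ hρ hρq hq1

end Budget

end SLIQN

theorem lemma3 {d n : ℕ} [NeZero n] (f : Fin n → EuclideanSpace ℝ (Fin d) → ℝ)
    (μ L Lt : ℝ) (hμ : 0 < μ) (hL : 0 < L) (hLt : 0 ≤ Lt)
    (hC2 : ∀ i, ContDiff ℝ 2 (f i))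
    (hconv : ∀ i, SLIQN.StronglyConvex μ (f i))
    (hsmooth : ∀ i, SLIQN.Smooth L (f i))
    (hlip : ∀ i, SLIQN.LipschitzHessian Lt (f i))
    (xs : EuclideanSpace ℝ (Fin d))
    (hxs : IsMinOn (fun y => (1 / (n : ℝ)) * ∑ i, f i y) Set.univ xs)
    (ρ : ℝ) (hρ0 : 0 < ρ) (hρ1 : ρ < 1 - μ / (d * L)) :
    ∃ ε σ₀ : ℝ, 0 < ε ∧ 0 < σ₀ ∧
      ∀ (x0 : EuclideanSpace ℝ (Fin d)) (I0 : Fin n → Matrix (Fin d) (Fin d) ℝ),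
        ‖x0 - xs‖ ≤ ε →
        (∀ i, (I0 i - SLIQN.hess (f i) x0).PosSemidef) →
        (∀ i, SLIQN.sigma (I0 i) (SLIQN.hess (f i) x0) ≤ σ₀) →
        ∀ (x : ℕ → EuclideanSpace ℝ (Fin d)) (z : ℕ → Fin n → EuclideanSpace ℝ (Fin d))
          (D : ℕ → Fin n → Matrix (Fin d) (Fin d) ℝ) (Q : ℕ → Matrix (Fin d) (Fin d) ℝ)
          (u : ℕ → Fin d → ℝ),
          SLIQN.IsRun f (SLIQN.alpha μ L Lt ε ρ) x0 I0 x z D Q u →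
          ∀ t : ℕ, 1 ≤ t →
            -- all matrices inverted or used as denominators are positive definite
            (∀ i, (D (t - 1) i).PosDef) ∧ (Q t).PosDef ∧
            -- `x (t - i)` is `x 0` when `t < i`
            ‖x t - xs‖ ≤ (1 - μ / (d * L)) ^ ⌈(t : ℝ) / n⌉₊ *
              ((1 / (n : ℝ)) * ∑ i ∈ Finset.Icc 1 n, ‖x (t - i) - xs‖) := by
  rcases d.eq_zero_or_pos with rfl | hd
  · exact ⟨1, 1, one_pos, one_pos, fun _ _ _ _ _ _ _ _ _ _ hrun =>
      absurd hrun.dim_pos (lt_irrefl 0)⟩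
  have hf (i : Fin n) : SLIQN.IsRegular μ L Lt (f i) := ⟨hC2 i, hconv i, hsmooth i, hlip i⟩
  have hgrad : ∑ i, gradient (f i) xs = 0 :=
    SLIQN.sum_gradient_eq_zero (fun i => (hC2 i).differentiable two_ne_zero xs)
      (one_div_ne_zero (NeZero.ne (n : ℝ))) (hxs.isLocalMin Filter.univ_mem)
  obtain ⟨ε, σ₀, R, m, b, hε, hσ₀, rfl, rfl, hbudget⟩ :=
    SLIQN.exists_errorBudget_alpha d hμ ((hconv 0).le_of_smooth hd (hsmooth 0)) hLt hρ0 hρ1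
      (sub_le_self 1 (by positivity))
  refine ⟨R 0, m 0, hε, hσ₀, fun x0 I0 hx0 hI0 hσ x z D Q u hrun t ht => ?_⟩
  obtain ⟨t, rfl⟩ := Nat.exists_eq_add_of_le' ht
  have hinv := hrun.blockInvariant hμ hL hLt hf hgrad (hρ0.trans hρ1).le hbudget hx0
    (fun i => Matrix.le_iff.2 (hI0 i)) hσ t
  exact ⟨hinv.posDef hbudget fun i => (hf i).posDef_hess hμ _,
    hrun.posDef_Q_succ hμ hL hLt hf hgrad hbudget hinv,
    hrun.norm_iterate_sub_le_pow_mul hμ hL hLt hf hgrad hbudget hinv⟩
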